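/- Let $H$ be a separable complex Hilbert space with a Hilbert basis $\Phi=(\phi_j)_{j\in\mathbf N}$, let $A,B$ be (possibly unbounded) linear operators on $H$, let $(\lambda_j)_{j\in\mathbf N}$ be real numbers, and let $a>0$, $b\ge 0$, $\alpha\in[0,1)$, $\delta\in(0,1)$. Assume: (1) $A$ is skew-adjoint, $\mathrm iA$ is bounded from below, $B$ is skew-symmetric, $D(A)\subset D(B)$ and $\|B\psi\|\le a\|A\psi\|+b\|\psi\|$ for all $\psi\in D(A)$; (2) $\phi_j\in D(A)$ and $A\phi_j=-\mathrm i\lambda_j\phi_j$ for all $j$, with $\lambda_j\to+\infty$, and there is $d\ge 0$ such that $D(|A|^\alpha)\subset D(B)$ and $\|B\psi\|\le d\,\||A|^\alpha\psi\|$ for all $\psi\in D(|A|^\alpha)$. Let $\mathcal U_{\delta,a}$ be the set of functions $u:\mathbf R\to(-(1-\delta)/a,(1-\delta)/a)$ of bounded variation on $\mathbf R$ with $u(t)=0$ for $t\le 0$. For $u\in\mathcal U_{\delta,a}$ let $\Upsilon^u_t$, $t\ge0$, denote the propagator of $\psi'=(A+u(t)B)\psi$: if $u$ is piecewise constant on $[0,t]$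 it is obtained by concatenation of the unitary groups $e^{\tau(A+cB)}$, where $c$ runs through the successive values of $u$; in general, for any $T>0$ and any sequence $u_n\in\mathcal U_{\delta,a}$ of controls that are piecewise constant on $[0,T]$, with $u_n\to u$ pointwise on $[0,T]$ and $TV_{[0,T]}(u_n)\le TV_{[0,T]}(u)$, one has $\Upsilon^u_t\psi=\lim_n\Upsilon^{u_n}_t\psi$ for $\psi\in D(A)$ and $t\in[0,T]$, and $\Upsilon^u_t$ is extended to $H$ by continuity. For $N\ge1$ let $\pi_N$ be the orthogonal projection onto the span of the first $N$ vectors of $\Phi$, let $A^{(\Phi,N)}=\pi_NA\pi_N$ and $B^{(\Phi,N)}=\pi_NB\pi_N$, and for $u\in L^1(\mathbf R)$ let $X^u_{(\Phi,N)}(t,s)$ be the propagator of the Galerkin approximation $\dot x=(A^{(\Phi,N)}+u(t)B^{(\Phi,N)})x$ of order $N$. Then for every $\varepsilon>0$, $K\ge0$, $n\in\mathbf N$ and $\psi_1,\dots,\psi_n\in D(|A|)$ there exists $N\ge 1$ such that for every $u\in\mathcal U_{\delta,a}\cap L^1(\mathbf R)$ with $\|u\|_{L^1}+TV_{\mathbf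 R}(u)<K$ the propagators $\Upsilon^u$ and $X^u_{(\Phi,N)}$ are well defined and $$\|\Upsilon^u_t\psi_j-X^u_{(\Phi,N)}(t,0)\,\pi_N\psi_j\|<\varepsilon\qquad\text{for all } t\ge0,\ j=1,\dots,n.$$ -/

import Mathlib

open scoped InnerProductSpace Topology
open MeasureTheory Filter Set

namespace BilinearControl

variable {H : Type*} [NormedAddCommGroup H] [InnerProductSpace ℂ H]

/-- Standing assumptions on a pair `(A, B)` of unbounded operators, with the two constants `a`, `b`
of the relative bound made explicit. -/
structure Hypothesis1 [CompleteSpace H] (A B : H →ₗ.[ℂ] H) (a b : ℝ) : Prop where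
  /-- `A` is skew-adjoint: densely defined with `A† = -A`. -/
  dense_domain : Dense (A.domain : Set H)
  skewAdjoint : A.adjoint = -A
  /-- `iA` is bounded from below. -/
  boundedBelow : ∃ m : ℝ, ∀ ψ : A.domain,
    m * ‖(ψ : H)‖ ^ 2 ≤ (⟪(ψ : H), Complex.I • A ψ⟫_ℂ).re
  /-- `B` is skew-symmetric. -/
  skewSymmetric : ∀ φ ψ : B.domain, ⟪B φ, (ψ : H)⟫_ℂ = -⟪(φ : H), B ψ⟫_ℂ
  a_nonneg : 0 ≤ a
  b_nonneg : 0 ≤ b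
  /-- `B` is defined on `D(A)` and `A`-bounded. -/
  relBound : ∀ ψ : A.domain, ∃ h : (ψ : H) ∈ B.domain,
    ‖B ⟨ψ, h⟩‖ ≤ a * ‖A ψ‖ + b * ‖(ψ : H)‖

/-- The sequence of coordinates `|lam j|^α ⟨φ j, ψ⟩`. -/
noncomputable def absPowCoord (φ : HilbertBasis ℕ ℂ H) (lam : ℕ → ℝ) (α : ℝ) : H →ₗ[ℂ] (ℕ → ℂ) where
  toFun ψ := fun j => ((|lam j| ^ α : ℝ) : ℂ) * ⟪φ j, ψ⟫_ℂ
  map_add' x y := by funext j; simp [mul_add]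
  map_smul' c x := by funext j; simp [mul_left_comm]

/-- The operator `|A|^α`, where `A` is the skew-adjoint operator that is diagonal in the Hilbert
basis `φ` with eigenvalues `-i lam j`. It is the self-adjoint operator multiplying the `j`-th
coordinate by `|lam j|^α`, on the domain of all `ψ` with
`∑ j, |lam j|^(2α) |⟨φ j, ψ⟩|² < ∞`; for `α = 0` it is the identity. -/
noncomputable def absPow (φ : HilbertBasis ℕ ℂ H) (lam : ℕ → ℝ) (α : ℝ) : H →ₗ.[ℂ] H where
  domain :=
    { carrier := {ψ | Memℓp (absPowCoord φ lam α ψ) 2}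
      zero_mem' := show Memℓp (absPowCoord φ lam α 0) 2 by
        rw [LinearMap.map_zero]; exact zero_memℓp
      add_mem' := fun {x y} hx hy => show Memℓp (absPowCoord φ lam α (x + y)) 2 by
        rw [LinearMap.map_add]; exact Memℓp.add hx hy
      smul_mem' := fun c x hx => show Memℓp (absPowCoord φ lam α (c • x)) 2 by
        rw [LinearMap.map_smul]; exact Memℓp.const_smul hx c }
  toFun := φ.repr.symm.toLinearEquiv.toLinearMap ∘ₗ
    { toFun := fun ψ => (⟨absPowCoord φ lam α (ψ : H), ψ.2⟩ : lp (fun _ : ℕ => ℂ) 2)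
      map_add' := fun x y => Subtype.ext (LinearMap.map_add (absPowCoord φ lam α) (x : H) (y : H))
      map_smul' := fun c x => Subtype.ext (LinearMap.map_smul (absPowCoord φ lam α) c (x : H)) }

/-- The assumptions in the diagonal case: `φ` is a Hilbert basis of eigenvectors of `A` with
`A φ_j = -i lam j φ_j` and `lam j → +∞` (so that `A` has discrete spectrum `(-i lam j)_j`), and `B`
is defined on `D(|A|^α)` and bounded there by `d ‖|A|^α ψ‖`. -/
structure Hypothesis2 [CompleteSpace H] (A B : H →ₗ.[ℂ] H) (φ : HilbertBasis ℕ ℂ H) (lam : ℕ → ℝ) (α a b : ℝ) :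
    Prop where
  hyp1 : Hypothesis1 A B a b
  alpha_nonneg : 0 ≤ α
  alpha_le_one : α ≤ 1
  tendsto_lam : Tendsto lam atTop atTop
  eigen : ∀ j, ∃ h : φ j ∈ A.domain, A ⟨φ j, h⟩ = (-Complex.I * (lam j : ℂ)) • φ j
  fracBound : ∃ d : ℝ, 0 ≤ d ∧ ∀ ψ : (absPow φ lam α).domain, ∃ h : (ψ : H) ∈ B.domain,
    ‖B ⟨ψ, h⟩‖ ≤ d * ‖absPow φ lam α ψ‖

/-- The controls `u : ℝ → ℝ` of bounded variation that vanish on `(-∞, 0]` and take values in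
`(-(1-δ)/a, (1-δ)/a)`. -/
def controls (δ a : ℝ) : Set (ℝ → ℝ) :=
  {u | BoundedVariationOn u univ ∧ (∀ t ≤ 0, u t = 0) ∧
    ∀ t, u t ∈ Ioo (-((1 - δ) / a)) ((1 - δ) / a)}

/-- `U t = e^{tT}`: `U` is a strongly continuous one-parameter unitary group on `H` whose
infinitesimal generator is exactly `T`. -/
structure IsUnitaryGroup (T : H →ₗ.[ℂ] H) (U : ℝ → H →L[ℂ] H) : Prop where
  map_zero : U 0 = 1
  map_sum : ∀ s t, U (s + t) = U s ∘L U t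
  isometric : ∀ t ψ, ‖U t ψ‖ = ‖ψ‖
  continuous : ∀ ψ, Continuous fun t => U t ψ
  generator : ∀ ψ η, HasDerivAt (fun t => U t ψ) η 0 ↔ ∃ h : ψ ∈ T.domain, T ⟨ψ, h⟩ = η

/-- `StepPropagator A B u t V`: the control `u` is piecewise constant on `[0, t]` and `V` is its
propagator `Υ^u_t`, obtained by concatenation of the groups `e^{τ(A + cB)}`. -/
inductive StepPropagator (A B : H →ₗ.[ℂ] H) (u : ℝ → ℝ) : ℝ → (H →L[ℂ] H) → Prop
  | zero : StepPropagator A B u 0 1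
  | step {s : ℝ} {V : H →L[ℂ] H} (hV : StepPropagator A B u s V) (τ c : ℝ) (hτ : 0 ≤ τ)
      (hc : ∀ r ∈ Ioo s (s + τ), u r = c) (U : ℝ → H →L[ℂ] H)
      (hU : IsUnitaryGroup (A + (c : ℂ) • B) U) :
      StepPropagator A B u (s + τ) (U τ ∘L V)

/-- The sequence `un` of admissible controls, piecewise constant on `[0, T]` with propagators
`Υn n t`, approximates `u` on `[0, T]`: pointwise, with total variation at most that of `u`. -/
structure IsStepApproximation (A B : H →ₗ.[ℂ] H) (δ a : ℝ) (u : ℝ → ℝ) (T : ℝ)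
    (un : ℕ → ℝ → ℝ) (Υn : ℕ → ℝ → H →L[ℂ] H) : Prop where
  mem_controls : ∀ n, un n ∈ controls δ a
  step : ∀ n, ∀ t ∈ Icc 0 T, StepPropagator A B (un n) t (Υn n t)
  pointwise : ∀ t ∈ Icc 0 T, Tendsto (fun n => un n t) atTop (𝓝 (u t))
  variation_le : ∀ n, eVariationOn (un n) (Icc 0 T) ≤ eVariationOn u (Icc 0 T)

/-- `Υ` is the propagator `t ↦ Υ^u_t`, `t ≥ 0`, of `ψ' = (A + u(t) B) ψ` for a control `u` of bounded
variation: for `ψ ∈ D(A)` the vector `Υ^u_t ψ` is the limit of `Υ^{u_n}_t ψ` along approximations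
of `u` by piecewise constant controls `u_n` (these exist, and the limit does not depend on the
choice), and `Υ^u_t` is the continuous extension to `H`. -/
def IsPropagator (A B : H →ₗ.[ℂ] H) (δ a : ℝ) (u : ℝ → ℝ) (Υ : ℝ → H →L[ℂ] H) : Prop :=
  ∀ T : ℝ, 0 ≤ T → (∃ un Υn, IsStepApproximation A B δ a u T un Υn) ∧
    ∀ un Υn, IsStepApproximation A B δ a u T un Υn → ∀ t ∈ Icc 0 T, ∀ ψ ∈ A.domain,
      Tendsto (fun n => Υn n t ψ) atTop (𝓝 (Υ t ψ))

theorem IsPropagator.unique {A B : H →ₗ.[ℂ] H} {δ a : ℝ} {u : ℝ → ℝ} {Υ Υ' : ℝ → H →L[ℂ] H}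
    (hA : Dense (A.domain : Set H)) (h : IsPropagator A B δ a u Υ)
    (h' : IsPropagator A B δ a u Υ') {t : ℝ} (ht : 0 ≤ t) : Υ t = Υ' t := by
  obtain ⟨un, Υn, hn⟩ := (h t ht).1
  have key : EqOn (Υ t) (Υ' t) (A.domain : Set H) := fun ψ hψ =>
    tendsto_nhds_unique ((h t ht).2 un Υn hn t ⟨ht, le_rfl⟩ ψ hψ)
      ((h' t ht).2 un Υn hn t ⟨ht, le_rfl⟩ ψ hψ)
  exact ContinuousLinearMap.ext fun x =>
    congrFun (Continuous.ext_on hA (Υ t).continuous (Υ' t).continuous key) x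

open Classical in
/-- The propagator `t ↦ Υ^u_t` of `ψ' = (A + u(t) B) ψ`. -/
noncomputable def propagator (A B : H →ₗ.[ℂ] H) (δ a : ℝ) (u : ℝ → ℝ) : ℝ → H →L[ℂ] H :=
  if h : ∃ Υ, IsPropagator A B δ a u Υ then h.choose else fun _ => 0

/-- `π_N ψ = ∑ ⟨φ_j, ψ⟩ φ_j`, the sum running over the first `N` basis vectors. -/
noncomputable def proj (φ : HilbertBasis ℕ ℂ H) (N : ℕ) : H →L[ℂ] H :=
  ∑ j ∈ Finset.range N, (innerSL ℂ (φ j)).smulRight (φ j)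

open Classical in
/-- The value `T x`, extended by `0` outside of the domain of `T`; used only for `x ∈ D(T)`. -/
noncomputable def value (T : H →ₗ.[ℂ] H) (x : H) : H :=
  if h : x ∈ T.domain then T ⟨x, h⟩ else 0

/-- The compression `π_N T π_N`, as a finite rank operator on `H`: it maps `ψ` to
`∑ ⟨φ_k, ψ⟩ π_N T φ_k`, the sum running over the first `N` basis vectors. -/
noncomputable def compression (T : H →ₗ.[ℂ] H) (φ : HilbertBasis ℕ ℂ H) (N : ℕ) : H →L[ℂ] H :=
  ∑ k ∈ Finset.range N, (innerSL ℂ (φ k)).smulRight (proj φ N (value T (φ k)))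

/-- `X t s` is the propagator of the Galerkin approximation
`x' = (A^{(Φ,N)} + u(t) B^{(Φ,N)}) x` of order `N`, for a locally integrable `u`
(Carathéodory solutions, in integral form). -/
def IsGalerkinPropagator (A B : H →ₗ.[ℂ] H) (φ : HilbertBasis ℕ ℂ H) (N : ℕ) (u : ℝ → ℝ)
    (X : ℝ → ℝ → H →L[ℂ] H) : Prop :=
  ∀ s : ℝ, Continuous (fun t => X t s) ∧
    ∀ t : ℝ, X t s = 1 + ∫ r in s..t,
      (compression A φ N + (u r : ℂ) • compression B φ N) ∘L X r s

open Classical in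
/-- The propagator `X^u_{(Φ,N)}(t, s)` of the Galerkin approximation of order `N`. -/
noncomputable def galerkinPropagator (A B : H →ₗ.[ℂ] H) (φ : HilbertBasis ℕ ℂ H) (N : ℕ)
    (u : ℝ → ℝ) : ℝ → ℝ → H →L[ℂ] H :=
  if h : ∃ X, IsGalerkinPropagator A B φ N u X then h.choose else fun _ _ => 0

end BilinearControl

open BilinearControl

/-! The evolution is nearly finite dimensional because its trajectories stay bounded in the graph
norm of `A`, uniformly in time and in the control, while `B` is small on the high modes of such
vectors. Indeed `B` is bounded by `|A|^α` with `α < 1` and `lam j → ∞`, so for `x ∈ D(A)` both `x -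
π_N x` and `B (x - π_N x)` have norm at most `ε_N ‖A x‖` with `ε_N → 0` (`Hypothesis2.tail`).

A priori bound. While the control has the constant value `c`, the group of `A + cB` preserves `‖(A +
cB)ψ‖` and `‖ψ‖`. Since `|c| a ≤ 1 - δ`, the operator `A` is bounded relative to `A + cB`, and
passing from `c` to `c'` costs at most a factor `exp((a/δ)|c' - c|)`. Hence `‖A Υ_t ψ‖` is
controlled by the total variation alone (`DiagonalPair.norm_diag_stepPropagator_le`).

Comparison. Because `π_N` commutes with `A`, the projected trajectory solves the Galerkin equation
up to the defect `u π_N B (1 - π_N) Υ_t ψ`. The Galerkin generator is skew, so this defect is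
integrated without any exponential factor (`norm_le_of_skew_integral_eq`). The total error is at
most `ε_N C (1 + ‖u‖_{L¹})`, which is why one `N` serves all times and all controls.

For a general `u` the comparison is made between step controls `w` and the Galerkin system of `u`
itself. The extra error is a multiple of `‖B^{(N)}‖ ∫ |w - u|`, which vanishes as `w → u` for fixed
`N`. The same estimate forces all step approximations to have a common limit, so it also yields the
existence of the propagator (`DiagonalPair.exists_limit_propagator`).

The groups of `A + cB` are themselves strong limits of Galerkin flows, by the same tail estimate
(`DiagonalPair.exists_isUnitaryGroup`). -/

namespace BilinearControl

variable {H : Type*} [NormedAddCommGroup H] [InnerProductSpace ℂ H]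

/-! ### Coordinates and projections in a Hilbert basis -/

section Coordinates

variable (φ : HilbertBasis ℕ ℂ H)

theorem summable_norm_inner_sq (x : H) : Summable fun j => ‖⟪φ j, x⟫_ℂ‖ ^ 2 := by
  have := (lp.memℓp (φ.repr x)).summable (by norm_num)
  simpa [φ.repr_apply_apply] using this

theorem norm_sq_eq_tsum_inner (x : H) : ‖x‖ ^ 2 = ∑' j, ‖⟪φ j, x⟫_ℂ‖ ^ 2 := by
  have := lp.norm_rpow_eq_tsum (p := 2) (by norm_num) (φ.repr x)
  simpa [φ.repr_apply_apply] using this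

theorem eq_of_inner_eq {x y : H} (h : ∀ j, ⟪φ j, x⟫_ℂ = ⟪φ j, y⟫_ℂ) : x = y := by
  apply φ.repr.injective
  ext j
  simpa [φ.repr_apply_apply] using h j

theorem norm_le_of_inner_le {x y : H} {C : ℝ} (hC : 0 ≤ C)
    (h : ∀ j, ‖⟪φ j, x⟫_ℂ‖ ≤ C * ‖⟪φ j, y⟫_ℂ‖) : ‖x‖ ≤ C * ‖y‖ := by
  refine le_of_sq_le_sq ?_ (by positivity)
  rw [mul_pow, norm_sq_eq_tsum_inner φ x, norm_sq_eq_tsum_inner φ y, ← tsum_mul_left]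
  refine (summable_norm_inner_sq φ x).tsum_le_tsum (fun j => ?_)
    ((summable_norm_inner_sq φ y).mul_left _)
  rw [← mul_pow]
  gcongr
  exact h j

theorem memℓp_of_norm_le_inner {f : ℕ → ℂ} {y : H} {C : ℝ}
    (h : ∀ j, ‖f j‖ ≤ C * ‖⟪φ j, y⟫_ℂ‖) : Memℓp f 2 := by
  refine memℓp_gen ?_
  refine Summable.of_nonneg_of_le (fun j => by positivity) (fun j => ?_)
    ((summable_norm_inner_sq φ y).mul_left (C ^ 2))
  rw [← mul_pow]
  simpa using pow_le_pow_left₀ (norm_nonneg _) (h j) 2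

theorem exists_of_memℓp {f : ℕ → ℂ} (h : Memℓp f 2) : ∃ x : H, ∀ j, ⟪φ j, x⟫_ℂ = f j :=
  ⟨φ.repr.symm ⟨f, h⟩, fun j => by rw [← φ.repr_apply_apply, LinearIsometryEquiv.apply_symm_apply]⟩

theorem inner_basis (j k : ℕ) : ⟪φ j, φ k⟫_ℂ = if j = k then 1 else 0 :=
  orthonormal_iff_ite.1 φ.orthonormal j k

theorem proj_apply (N : ℕ) (x : H) : proj φ N x = ∑ j ∈ Finset.range N, ⟪φ j, x⟫_ℂ • φ j := by
  simp [proj]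

theorem inner_proj (N j : ℕ) (x : H) :
    ⟪φ j, proj φ N x⟫_ℂ = if j < N then ⟪φ j, x⟫_ℂ else 0 := by
  simp [proj_apply, inner_basis]

theorem norm_proj_le (N : ℕ) (x : H) : ‖proj φ N x‖ ≤ ‖x‖ := by
  have := norm_le_of_inner_le φ (x := proj φ N x) (y := x) zero_le_one (fun j => by
    rw [inner_proj]; split_ifs <;> simp)
  simpa using this

theorem proj_proj_of_le {N M : ℕ} (h : N ≤ M) (x : H) : proj φ N (proj φ M x) = proj φ N x := by
  refine eq_of_inner_eq φ fun j => ?_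
  simp only [inner_proj]
  split_ifs <;> first | rfl | omega

theorem inner_proj_left (N : ℕ) (x y : H) : ⟪proj φ N x, y⟫_ℂ = ⟪x, proj φ N y⟫_ℂ := by
  simp only [proj_apply, sum_inner, inner_sum, inner_smul_left, inner_smul_right]
  refine Finset.sum_congr rfl fun j _ => ?_
  rw [inner_conj_symm, mul_comm]

theorem tendsto_proj (x : H) : Tendsto (fun N => proj φ N x) atTop (𝓝 x) := by
  have := (φ.hasSum_repr x).tendsto_sum_nat
  simpa [proj_apply, φ.repr_apply_apply] using this

theorem inner_absPow {lam : ℕ → ℝ} {α : ℝ} (x : (absPow φ lam α).domain) (j : ℕ) :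
    ⟪φ j, absPow φ lam α x⟫_ℂ = ((|lam j| ^ α : ℝ) : ℂ) * ⟪φ j, (x : H)⟫_ℂ := by
  rw [← φ.repr_apply_apply]
  change φ.repr (φ.repr.symm _) j = _
  rw [LinearIsometryEquiv.apply_symm_apply]
  rfl

end Coordinates

/-- A skew-adjoint operator `A` on `D` that is diagonal in the Hilbert basis `φ`, together with a
skew-symmetric, relatively bounded perturbation `B` that is uniformly small on the tails of `φ`. -/
structure DiagonalPair (D : Submodule ℂ H) (A B : D →ₗ[ℂ] H) (φ : HilbertBasis ℕ ℂ H)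
    (lam : ℕ → ℝ) (a b : ℝ) : Prop where
  coord : ∀ (x : D) (j : ℕ), ⟪φ j, A x⟫_ℂ = (-Complex.I * (lam j : ℂ)) * ⟪φ j, (x : H)⟫_ℂ
  mem_of_coord : ∀ x y : H, (∀ j, ⟪φ j, y⟫_ℂ = (-Complex.I * (lam j : ℂ)) * ⟪φ j, x⟫_ℂ) → x ∈ D
  skew : ∀ x y : D, ⟪B x, (y : H)⟫_ℂ = -⟪(x : H), B y⟫_ℂ
  a_pos : 0 < a
  b_nonneg : 0 ≤ b
  relBound : ∀ x : D, ‖B x‖ ≤ a * ‖A x‖ + b * ‖(x : H)‖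
  tail : ∀ ε > 0, ∃ N₀, ∀ N ≥ N₀, ∀ x y : D, (y : H) = x - proj φ N x →
    ‖(y : H)‖ ≤ ε * ‖A x‖ ∧ ‖B y‖ ≤ ε * ‖A x‖

/-! ### From the hypotheses to a diagonal pair -/

section Hypotheses

variable [CompleteSpace H] {A B : H →ₗ.[ℂ] H} {φ : HilbertBasis ℕ ℂ H} {lam : ℕ → ℝ}
  {α a b : ℝ}

theorem Hypothesis1.domain_le (h : Hypothesis1 A B a b) : A.domain ≤ B.domain :=
  fun x hx => (h.relBound ⟨x, hx⟩).1

theorem Hypothesis1.inner_skew (h : Hypothesis1 A B a b) (x y : A.domain) :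
    ⟪A x, (y : H)⟫_ℂ = -⟪(x : H), A y⟫_ℂ := by
  have hx : (x : H) ∈ A.adjoint.domain := by rw [h.skewAdjoint]; exact x.2
  have h1 := LinearPMap.adjoint_isFormalAdjoint h.dense_domain ⟨x, hx⟩ y
  have h2 : A.adjoint ⟨x, hx⟩ = - A x := by
    have : A.adjoint ≤ -A := h.skewAdjoint.le
    exact this.2 (x := ⟨x, hx⟩) (y := (x : (-A).domain)) rfl
  rw [h2] at h1
  rw [← h1, inner_neg_left, neg_neg]

theorem Hypothesis2.coord (h : Hypothesis2 A B φ lam α a b) (x : A.domain) (j : ℕ) :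
    ⟪φ j, A x⟫_ℂ = (-Complex.I * (lam j : ℂ)) * ⟪φ j, (x : H)⟫_ℂ := by
  obtain ⟨hj, e⟩ := h.eigen j
  have := h.hyp1.inner_skew ⟨φ j, hj⟩ x
  rw [e, inner_smul_left] at this
  simp only [map_mul, map_neg, Complex.conj_I, Complex.conj_ofReal, neg_neg] at this
  rw [eq_comm, neg_eq_iff_eq_neg] at this
  rw [this]; ring

/-- This is where skew-adjointness, and not mere skew-symmetry, enters: by Parseval such an `x` lies
in the domain of the adjoint, which is `D(A)`. So `D(A)` is the maximal domain of the diagonal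
operator. -/
theorem Hypothesis2.mem_of_coord (h : Hypothesis2 A B φ lam α a b) (x y : H)
    (hxy : ∀ j, ⟪φ j, y⟫_ℂ = (-Complex.I * (lam j : ℂ)) * ⟪φ j, x⟫_ℂ) : x ∈ A.domain := by
  have : x ∈ A.adjoint.domain := by
    refine LinearPMap.mem_adjoint_domain_of_exists _ ⟨-y, fun z => ?_⟩
    rw [← φ.tsum_inner_mul_inner, ← φ.tsum_inner_mul_inner]
    refine tsum_congr fun j => ?_
    rw [h.coord, ← inner_conj_symm (-y), ← inner_conj_symm x, inner_neg_right, hxy j]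
    simp only [map_neg, map_mul, Complex.conj_I, Complex.conj_ofReal]
    ring
  rwa [h.hyp1.skewAdjoint] at this

/-- The restriction of `B` to `D(A)`. -/
def restrictTo (B : H →ₗ.[ℂ] H) {D : Submodule ℂ H} (h : D ≤ B.domain) : D →ₗ[ℂ] H :=
  B.toFun ∘ₗ Submodule.inclusion h

theorem Hypothesis2.mem_domain_of_absPow_one (h : Hypothesis2 A B φ lam α a b) {x : H}
    (hx : x ∈ (absPow φ lam 1).domain) : x ∈ A.domain := by
  have hx' : Memℓp (absPowCoord φ lam 1 x) 2 := hx
  have : Memℓp (fun j => (-Complex.I * (lam j : ℂ)) * ⟪φ j, x⟫_ℂ) 2 := by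
    refine memℓp_gen ?_
    refine (hx'.summable (by norm_num)).congr fun j => ?_
    simp [absPowCoord]
  obtain ⟨y, hy⟩ := exists_of_memℓp φ this
  exact h.mem_of_coord x y hy

/-- The vector `y` has only modes with `|lam j| ≥ L`, and there `|lam j| ^ β ≤ L ^ (β - 1) * |lam
j|` for `β < 1`. The cases `β = 0` and `β = α` give the two bounds, with factors `L⁻¹` and `d * L ^
(α - 1)` that vanish as `L → ∞`. The strict inequality `α < 1` is essential. -/
theorem Hypothesis2.tail (h : Hypothesis2 A B φ lam α a b) (hα : α < 1) (ε : ℝ) (hε : 0 < ε) :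
    ∃ N₀, ∀ N ≥ N₀, ∀ x y : A.domain, (y : H) = x - proj φ N x →
      ‖(y : H)‖ ≤ ε * ‖A x‖ ∧ ‖restrictTo B h.hyp1.domain_le y‖ ≤ ε * ‖A x‖ := by
  obtain ⟨d, hd, hB⟩ := h.fracBound
  have l1 : Tendsto (fun L : ℝ => d * L ^ (α - 1)) atTop (𝓝 0) := by
    have := (tendsto_rpow_neg_atTop (y := 1 - α) (by linarith)).const_mul d
    simpa using this
  have l2 : Tendsto (fun L : ℝ => L⁻¹) atTop (𝓝 0) := tendsto_inv_atTop_zero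
  obtain ⟨L, h1, h2, hL⟩ := ((l1.eventually (gt_mem_nhds hε)).and
    ((l2.eventually (gt_mem_nhds hε)).and (eventually_gt_atTop 0))).exists
  obtain ⟨N₀, hN₀⟩ := eventually_atTop.1 (h.tendsto_lam.eventually_ge_atTop L)
  refine ⟨N₀, fun N hN x y hxy => ?_⟩
  have hc : ∀ j, ⟪φ j, (y : H)⟫_ℂ = if j < N then 0 else ⟪φ j, (x : H)⟫_ℂ := fun j => by
    rw [hxy, inner_sub_right, inner_proj]; split_ifs <;> simp
  have key : ∀ β : ℝ, β < 1 → ∀ j, |lam j| ^ β * ‖⟪φ j, (y : H)⟫_ℂ‖ ≤ L ^ (β - 1) * ‖⟪φ j, A x⟫_ℂ‖ := by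
    intro β hβ j
    rw [hc]
    split_ifs with hj
    · simp only [norm_zero, mul_zero]; positivity
    · have hl : L ≤ |lam j| := (hN₀ j (by omega)).trans (le_abs_self _)
      have hl0 : 0 < |lam j| := hL.trans_le hl
      rw [h.coord, norm_mul, norm_mul, norm_neg, Complex.norm_I, one_mul, Complex.norm_real,
        Real.norm_eq_abs, ← mul_assoc]
      gcongr
      calc |lam j| ^ β = |lam j| ^ (β - 1) * |lam j| := by
            rw [Real.rpow_sub_one hl0.ne']; field_simp
        _ ≤ L ^ (β - 1) * |lam j| := by
            exact mul_le_mul_of_nonneg_right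
              (Real.rpow_le_rpow_of_nonpos hL hl (by linarith)) hl0.le
  constructor
  · refine (norm_le_of_inner_le φ (y := A x) (C := L⁻¹) (by positivity) fun j => ?_).trans
      (by gcongr)
    simpa [Real.rpow_neg_one] using key 0 zero_lt_one j
  · have hk : ∀ j, ‖absPowCoord φ lam α y j‖ ≤ L ^ (α - 1) * ‖⟪φ j, A x⟫_ℂ‖ := fun j => by
      refine le_of_eq_of_le ?_ (key α hα j)
      simp only [absPowCoord, LinearMap.coe_mk, AddHom.coe_mk, norm_mul, Complex.norm_real]
      rw [Real.norm_of_nonneg (by positivity)]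
    have hy : (y : H) ∈ (absPow φ lam α).domain := memℓp_of_norm_le_inner φ hk
    obtain ⟨h', hb⟩ := hB ⟨y, hy⟩
    have hn : ‖absPow φ lam α ⟨y, hy⟩‖ ≤ L ^ (α - 1) * ‖A x‖ :=
      norm_le_of_inner_le φ (by positivity) fun j => by rw [inner_absPow]; exact hk j
    calc ‖restrictTo B h.hyp1.domain_le y‖ ≤ d * ‖absPow φ lam α ⟨y, hy⟩‖ := hb
      _ ≤ d * (L ^ (α - 1) * ‖A x‖) := by gcongr
      _ = d * L ^ (α - 1) * ‖A x‖ := by ring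
      _ ≤ ε * ‖A x‖ := by gcongr

theorem Hypothesis2.diagonalPair (h : Hypothesis2 A B φ lam α a b) (hα : α < 1) (ha : 0 < a) :
    DiagonalPair A.domain A.toFun (restrictTo B h.hyp1.domain_le) φ lam a b where
  coord := h.coord
  mem_of_coord := h.mem_of_coord
  skew x y := h.hyp1.skewSymmetric (Submodule.inclusion h.hyp1.domain_le x)
    (Submodule.inclusion h.hyp1.domain_le y)
  a_pos := ha
  b_nonneg := h.hyp1.b_nonneg
  relBound x := (h.hyp1.relBound x).2
  tail := h.tail hα

end Hypotheses

/-! ### Norm estimate for forced skew equations -/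

section SkewIntegralEquation

theorem norm_add_le_of_re_inner_eq_zero {x v : H} {k : ℝ} (h : (⟪x, v⟫_ℂ).re = 0)
    (hv : ‖v‖ ≤ k * ‖x‖) : ‖x + v‖ ≤ (1 + k ^ 2) * ‖x‖ := by
  refine le_of_sq_le_sq ?_ (by positivity)
  have e := norm_add_sq (𝕜 := ℂ) x v
  simp only [RCLike.re_to_complex, h, mul_zero, add_zero] at e
  have h2 : ‖v‖ ^ 2 ≤ (k * ‖x‖) ^ 2 := by gcongr
  rw [e]
  nlinarith [mul_nonneg (sq_nonneg k) (sq_nonneg ‖x‖), mul_nonneg (sq_nonneg (k ^ 2)) (sq_nonneg ‖x‖)]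

/-- A skew generator does not change the norm, so only the forcing contributes; Gronwall's lemma
would give a factor exponential in time. The coefficient is merely integrable in time and `z` need
not be differentiable, so the argument bounds right difference quotients of `‖z x‖ - ∫ g`. -/
theorem norm_le_of_skew_integral_eq [CompleteSpace H] {C : ℝ → H →L[ℂ] H} {L : ℝ}
    (hL : ∀ r, ‖C r‖ ≤ L) (hskew : ∀ r x, (⟪x, C r x⟫_ℂ).re = 0) {s t : ℝ} (hst : s ≤ t)
    {z f : ℝ → H} {g : ℝ → ℝ} (hz : ContinuousOn z (Icc s t))
    (hC : ∀ x, IntervalIntegrable (fun r => C r x) volume s t)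
    (hCz : IntervalIntegrable (fun r => C r (z r)) volume s t)
    (hf : IntervalIntegrable f volume s t) (hg : IntervalIntegrable g volume s t)
    (hfg : ∀ r ∈ Icc s t, ‖f r‖ ≤ g r)
    (heq : ∀ r ∈ Icc s t, z r = z s + ∫ q in s..r, (C q (z q) + f q)) :
    ‖z t‖ ≤ ‖z s‖ + ∫ q in s..t, g q := by
  have hL0 : 0 ≤ L := (norm_nonneg _).trans (hL 0)
  have hsub : ∀ {x y : ℝ}, s ≤ x → x ≤ y → y ≤ t → uIcc x y ⊆ uIcc s t := fun h1 h2 h3 => by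
    rw [uIcc_of_le h2, uIcc_of_le hst]; exact Icc_subset_Icc h1 h3
  have main : ∀ ⦃x⦄, x ∈ Icc s t → ‖z x‖ - ∫ q in s..x, g q ≤ ‖z s‖ := by
    refine image_le_of_liminf_slope_right_le_deriv_boundary (B' := fun _ => 0) ?_ ?_
      continuousOn_const (fun x _ => hasDerivWithinAt_const _ _ _) ?_
    · refine hz.norm.sub ?_
      rw [← uIcc_of_le hst]
      exact intervalIntegral.continuousOn_primitive_interval ((intervalIntegrable_iff' (by simp)).1 hg)
    · simp
    · intro x hx r hr
      have hCL : Tendsto (fun y => (y - x) * (L ^ 2 * ‖z x‖)) (𝓝[>] x) (𝓝 0) := by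
        have : Continuous fun y : ℝ => (y - x) * (L ^ 2 * ‖z x‖) := by fun_prop
        have := (this.tendsto x).mono_left (nhdsWithin_le_nhds (s := Ioi x))
        simpa using this
      have hr4 : 0 < r / (4 * (L + 1)) := by positivity
      have hzx : ∀ᶠ y in 𝓝[>] x, ∀ q ∈ Icc x y, ‖z q - z x‖ ≤ r / (4 * (L + 1)) := by
        have h1 : ∀ᶠ q in 𝓝[Icc s t] x, ‖z q - z x‖ < r / (4 * (L + 1)) := by
          have := Metric.continuousWithinAt_iff'.1 (hz x (Ico_subset_Icc_self hx)) _ hr4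
          simpa [dist_eq_norm] using this
        have h2 : ∀ᶠ q in 𝓝[≥] x, ‖z q - z x‖ < r / (4 * (L + 1)) := by
          refine h1.filter_mono ?_
          rw [← nhdsWithin_Icc_eq_nhdsGE hx.2]
          exact nhdsWithin_mono _ (Icc_subset_Icc_left hx.1)
        obtain ⟨y₀, hy₀, h3⟩ := (mem_nhdsGE_iff_exists_Icc_subset.1 h2)
        filter_upwards [Ioo_mem_nhdsGT hy₀] with y hy q hq
        exact (h3 ⟨hq.1, hq.2.trans hy.2.le⟩ : _ < _).le
      refine Eventually.frequently ?_
      filter_upwards [hzx, hCL.eventually (gt_mem_nhds (half_pos hr)),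
        Ioo_mem_nhdsGT hx.2] with y hy1 hy2 hy3
      have hxy : x < y := hy3.1
      have hS := hsub hx.1 hxy.le hy3.2.le
      have hS' := hsub le_rfl hx.1 hx.2.le
      have hzy : z y - z x = (∫ q in x..y, C q (z q)) + ∫ q in x..y, f q := by
        rw [heq y ⟨hx.1.trans hxy.le, hy3.2.le⟩, heq x (Ico_subset_Icc_self hx),
          add_sub_add_left_eq_sub, intervalIntegral.integral_interval_sub_left
            ((hCz.add hf).mono_set (hsub le_rfl (hx.1.trans hxy.le) hy3.2.le))
            ((hCz.add hf).mono_set hS')]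
        exact intervalIntegral.integral_add (hCz.mono_set hS) (hf.mono_set hS)
      -- Freezing `z` at time `x` makes the increment `v` orthogonal to `z x` in the real sense, so
      -- it changes the norm only to second order in `y - x`. By continuity of `z`, the freezing
      -- error is at most `(r / 4) * (y - x)`.
      set v := ∫ q in x..y, C q (z x) with hv
      have hvre : (⟪z x, v⟫_ℂ).re = 0 := by
        have := (Complex.reCLM.comp ((innerSL ℂ (z x)).restrictScalars ℝ)).intervalIntegral_comp_comm
          ((hC (z x)).mono_set hS)
        simp only [ContinuousLinearMap.comp_apply, ContinuousLinearMap.coe_restrictScalars',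
          innerSL_apply_apply, Complex.reCLM_apply, hskew, intervalIntegral.integral_zero] at this
        exact this.symm
      have hvn : ‖v‖ ≤ (L * (y - x)) * ‖z x‖ := by
        have := intervalIntegral.norm_integral_le_of_norm_le_const (a := x) (b := y)
          (f := fun q => C q (z x)) (C := L * ‖z x‖) fun q _ => (C q).le_of_opNorm_le (hL q) _
        rw [abs_of_pos (sub_pos.2 hxy)] at this
        linarith
      have hw : ‖(∫ q in x..y, C q (z q)) - v‖ ≤ (r / 4) * (y - x) := by
        rw [hv, ← intervalIntegral.integral_sub (hCz.mono_set hS) ((hC _).mono_set hS)]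
        have := intervalIntegral.norm_integral_le_of_norm_le_const (a := x) (b := y)
          (f := fun q => C q (z q) - C q (z x)) (C := r / 4) fun q hq => by
            rw [uIoc_of_le hxy.le] at hq
            rw [← map_sub]
            calc ‖C q (z q - z x)‖ ≤ L * (r / (4 * (L + 1))) :=
                  (C q).le_of_opNorm_le_of_le (hL q) (hy1 q ⟨hq.1.le, hq.2⟩)
              _ ≤ (L + 1) * (r / (4 * (L + 1))) := by gcongr; linarith
              _ = r / 4 := by field_simp
        rwa [abs_of_pos (sub_pos.2 hxy)] at this
      have hfn : ‖∫ q in x..y, f q‖ ≤ ∫ q in x..y, g q :=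
        intervalIntegral.norm_integral_le_of_norm_le hxy.le
          (ae_of_all _ fun q hq => hfg q ⟨hx.1.trans hq.1.le, hq.2.trans hy3.2.le⟩)
          (hg.mono_set hS)
      have hG : (∫ q in s..y, g q) - (∫ q in s..x, g q) = ∫ q in x..y, g q :=
        intervalIntegral.integral_interval_sub_left
          (hg.mono_set (hsub le_rfl (hx.1.trans hxy.le) hy3.2.le)) (hg.mono_set hS')
      have h1 : ‖z y‖ ≤ ‖z x + v‖ + ‖(∫ q in x..y, C q (z q)) - v‖ + ‖∫ q in x..y, f q‖ := by
        have : z y = (z x + v) + ((∫ q in x..y, C q (z q)) - v) + ∫ q in x..y, f q := by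
          rw [← sub_add_cancel (z y) (z x), hzy]; abel
        rw [this]
        exact norm_add₃_le
      have h2 := norm_add_le_of_re_inner_eq_zero hvre hvn
      rw [slope_def_field, div_lt_iff₀ (sub_pos.2 hxy)]
      have hd := sub_pos.2 hxy
      nlinarith [mul_lt_mul_of_pos_right hy2 hd]
  have := main (right_mem_Icc.2 hst)
  linarith

end SkewIntegralEquation

/-! ### Existence of the Galerkin propagator -/

section LinearIntegralEquation

open BoundedContinuousFunction in
/-- Global solvability of the linear integral equation `X(t) = 1 + ∫ₛᵗ C(r) X(r) dr` with bounded
measurable coefficients. -/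
theorem exists_continuous_integral_eq {R : Type*} [NormedRing R] [NormedAlgebra ℝ R]
    [CompleteSpace R] {C : ℝ → R} {L : ℝ} (hC : StronglyMeasurable C) (hL : ∀ r, ‖C r‖ ≤ L)
    (s : ℝ) : ∃ X : ℝ → R, Continuous X ∧ ∀ t, X t = 1 + ∫ r in s..t, C r * X r := by
  have hL0 : 0 ≤ L := (norm_nonneg _).trans (hL 0)
  -- Substituting `X = w • Y` with `w r = cosh (k (r - s))` gives a contraction on all of `ℝ`,
  -- forward and backward in time. The integral of `w` is `sinh / k`, of modulus at most `w / k`, so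
  -- the Lipschitz constant is at most `L / k ≤ 1 / 2`.
  set k : ℝ := 2 * (L + 1) with hk
  have hk0 : 0 < k := by positivity
  set w : ℝ → ℝ := fun r => Real.cosh (k * (r - s)) with hw
  have hw0 : ∀ r, 0 < w r := fun r => Real.cosh_pos _
  have hwc : Continuous w := Real.continuous_cosh.comp (by fun_prop)
  have hint : ∀ (Y : ℝ → R), Continuous Y → ∀ p q,
      IntervalIntegrable (fun r => C r * Y r) volume p q := fun Y hY p q => by
    refine IntervalIntegrable.mono_fun (g := fun r => C r * Y r) (f := fun r => L * ‖Y r‖)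
      (Continuous.intervalIntegrable (by fun_prop) _ _)
      (hC.mul hY.stronglyMeasurable).aestronglyMeasurable (ae_of_all _ fun r => ?_)
    calc ‖C r * Y r‖ ≤ ‖C r‖ * ‖Y r‖ := norm_mul_le _ _
      _ ≤ L * ‖Y r‖ := by gcongr; exact hL r
      _ ≤ ‖L * ‖Y r‖‖ := Real.le_norm_self _
  have hest : ∀ (Z : ℝ → R) (m : ℝ), 0 ≤ m → (∀ r, ‖Z r‖ ≤ m) → ∀ t,
      ‖(w t)⁻¹ • ∫ r in s..t, C r * (w r • Z r)‖ ≤ 1 / 2 * m := by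
    intro Z m hm hZ t
    have h1 : ‖∫ r in s..t, C r * (w r • Z r)‖ ≤ |∫ r in s..t, L * m * w r| := by
      refine intervalIntegral.norm_integral_le_abs_of_norm_le (ae_of_all _ fun r => ?_)
        (Continuous.intervalIntegrable (by fun_prop) _ _)
      calc ‖C r * (w r • Z r)‖ ≤ ‖C r‖ * ‖w r • Z r‖ := norm_mul_le _ _
        _ = ‖C r‖ * ‖Z r‖ * w r := by
          rw [norm_smul, Real.norm_of_nonneg (hw0 r).le]; ring
        _ ≤ L * m * w r := by
          have := (hw0 r).le
          gcongr
          · exact hL r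
          · exact hZ r
    have h2 : ∫ r in s..t, L * m * w r = L * m * (Real.sinh (k * (t - s)) / k) := by
      rw [intervalIntegral.integral_const_mul]
      congr 1
      have hd : ∀ r ∈ uIcc s t, HasDerivAt (fun r => Real.sinh (k * (r - s)) / k) (w r) r :=
        fun r _ => by
          have := ((((hasDerivAt_id r).sub_const s).const_mul k).sinh).div_const k
          convert! this using 1
          simp only [id, hw]; field_simp
      rw [intervalIntegral.integral_eq_sub_of_hasDerivAt hd (hwc.intervalIntegrable _ _)]
      simp
    have h3 : |Real.sinh (k * (t - s))| ≤ w t := by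
      rw [abs_le]
      constructor
      · have := Real.exp_pos (k * (t - s))
        rw [← Real.cosh_add_sinh] at this; simp only [hw]; linarith
      · exact (Real.sinh_lt_cosh _).le
    rw [norm_smul, norm_inv, Real.norm_of_nonneg (hw0 t).le, inv_mul_le_iff₀ (hw0 t)]
    refine h1.trans ?_
    rw [h2, abs_mul, abs_div, abs_of_nonneg (by positivity : 0 ≤ L * m), abs_of_pos hk0]
    calc L * m * (|Real.sinh (k * (t - s))| / k) ≤ (L + 1) * m * (w t / k) := by
          gcongr; linarith
      _ = w t * (1 / 2 * m) := by rw [hk]; field_simp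
  have hcont : ∀ Y : ℝ →ᵇ R, Continuous fun r => w r • Y r := fun Y => hwc.smul Y.continuous
  let Φ : (ℝ →ᵇ R) → (ℝ →ᵇ R) := fun Y => BoundedContinuousFunction.ofNormedAddCommGroup
    (fun t => (w t)⁻¹ • (1 + ∫ r in s..t, C r * (w r • Y r)))
    ((hwc.inv₀ fun t => (hw0 t).ne').smul (continuous_const.add
      (intervalIntegral.continuous_primitive (fun p q => hint _ (hcont Y) p q) s)))
    (‖(1 : R)‖ + 1 / 2 * ‖Y‖) (fun t => by
      rw [smul_add]
      refine (norm_add_le _ _).trans (add_le_add ?_ (hest _ _ (norm_nonneg _) Y.norm_coe_le_norm t))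
      rw [norm_smul, norm_inv, Real.norm_of_nonneg (hw0 t).le]
      exact mul_le_of_le_one_left (norm_nonneg _) (inv_le_one_of_one_le₀ (Real.one_le_cosh _)))
  have hΦ : ∀ Y t, Φ Y t = (w t)⁻¹ • (1 + ∫ r in s..t, C r * (w r • Y r)) := fun _ _ => rfl
  have hcontr : ContractingWith (1 / 2) Φ := by
    refine ⟨by norm_num, LipschitzWith.of_dist_le_mul fun Y Z => ?_⟩
    rw [BoundedContinuousFunction.dist_le (by positivity)]
    intro t
    have : Φ Y t - Φ Z t = (w t)⁻¹ • ∫ r in s..t, C r * (w r • (Y - Z) r) := by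
      rw [hΦ, hΦ, ← smul_sub, add_sub_add_left_eq_sub,
        ← intervalIntegral.integral_sub (hint _ (hcont Y) _ _) (hint _ (hcont Z) _ _)]
      simp [mul_sub, smul_sub]
    rw [dist_eq_norm, this, dist_eq_norm]
    simpa using hest (Y - Z) _ (norm_nonneg _) (Y - Z).norm_coe_le_norm t
  have hfix := hcontr.fixedPoint_isFixedPt
  set Y := hcontr.fixedPoint Φ
  refine ⟨fun t => w t • Y t, hcont Y, fun t => ?_⟩
  have h := congrArg (fun F : ℝ →ᵇ R => w t • F t) hfix
  simp only [hΦ, smul_inv_smul₀ (hw0 t).ne'] at h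
  exact h.symm

end LinearIntegralEquation

theorem exists_isGalerkinPropagator [CompleteSpace H] (A B : H →ₗ.[ℂ] H)
    (φ : HilbertBasis ℕ ℂ H) (N : ℕ) {u : ℝ → ℝ} (hu : Measurable u) {M : ℝ}
    (hM : ∀ t, |u t| ≤ M) : ∃ X, IsGalerkinPropagator A B φ N u X := by
  have hC : StronglyMeasurable fun r => compression A φ N + (u r : ℂ) • compression B φ N :=
    stronglyMeasurable_const.add
      ((Complex.measurable_ofReal.comp hu).stronglyMeasurable.smul_const _)
  have hL : ∀ r, ‖compression A φ N + (u r : ℂ) • compression B φ N‖ ≤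
      ‖compression A φ N‖ + M * ‖compression B φ N‖ := fun r => by
    refine (norm_add_le _ _).trans ?_
    rw [norm_smul, Complex.norm_real, Real.norm_eq_abs]
    gcongr
    exact hM r
  choose X hX using exists_continuous_integral_eq hC hL
  exact ⟨fun t s => X s t, hX⟩

/-! ### Exponential flows of bounded operators and strong limits -/

section Flow

/-- The one-parameter group `e^{tG}` of a bounded operator. -/
noncomputable def expFlow (G : H →L[ℂ] H) (t : ℝ) : H →L[ℂ] H := NormedSpace.exp (t • G)

theorem expFlow_zero (G : H →L[ℂ] H) : expFlow G 0 = 1 := by simp [expFlow]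

theorem expFlow_commute {G P : H →L[ℂ] H} (h : Commute P G) (t : ℝ) :
    Commute P (expFlow G t) := (h.smul_right t).exp_right

theorem hasDerivAt_norm_sq {f : ℝ → H} {f' : H} {t : ℝ} (hf : HasDerivAt f f' t) :
    HasDerivAt (fun r => ‖f r‖ ^ 2) (2 * (⟪f t, f'⟫_ℂ).re) t := by
  have h := Complex.reCLM.hasFDerivAt.comp_hasDerivAt t (hf.inner ℂ hf)
  have e : (fun r => ‖f r‖ ^ 2) = Complex.reCLM ∘ fun r => ⟪f r, f r⟫_ℂ := by
    funext r
    simp [inner_self_eq_norm_sq_to_K, ← Complex.ofReal_pow]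
  rw [e]
  refine h.congr_deriv ?_
  rw [Complex.reCLM_apply, Complex.add_re, ← inner_conj_symm f', Complex.conj_re]
  ring

variable [CompleteSpace H]

theorem expFlow_add (G : H →L[ℂ] H) (s t : ℝ) :
    expFlow G (s + t) = expFlow G s * expFlow G t := by
  let : NormedAlgebra ℚ (H →L[ℂ] H) := NormedAlgebra.restrictScalars ℚ ℂ _
  rw [expFlow, add_smul]
  exact NormedSpace.exp_add_of_commute (((Commute.refl G).smul_left s).smul_right t)

theorem hasDerivAt_expFlow (G : H →L[ℂ] H) (t : ℝ) :
    HasDerivAt (expFlow G) (expFlow G t * G) t := hasDerivAt_exp_smul_const G t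

theorem hasDerivAt_expFlow_apply (G : H →L[ℂ] H) (t : ℝ) (x : H) :
    HasDerivAt (fun r => expFlow G r x) (G (expFlow G t x)) t := by
  have h := ((ContinuousLinearMap.apply ℂ H x).restrictScalars ℝ).hasFDerivAt.comp_hasDerivAt t
    (hasDerivAt_expFlow G t)
  rw [← (expFlow_commute (Commute.refl G) t).eq] at h
  exact h

theorem norm_expFlow {G : H →L[ℂ] H} (hG : ∀ x y, ⟪G x, y⟫_ℂ = -⟪x, G y⟫_ℂ) (t : ℝ) (x : H) :
    ‖expFlow G t x‖ = ‖x‖ := by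
  have hre : ∀ y, (⟪y, G y⟫_ℂ).re = 0 := fun y => by
    have h1 := congrArg Complex.re (hG y y)
    rw [← inner_conj_symm, Complex.conj_re, Complex.neg_re] at h1
    linarith
  have hd : ∀ r, HasDerivAt (fun r => ‖expFlow G r x‖ ^ 2) 0 r := fun r => by
    have := hasDerivAt_norm_sq (hasDerivAt_expFlow_apply G r x)
    rwa [hre, mul_zero] at this
  have h := is_const_of_deriv_eq_zero (fun r => (hd r).differentiableAt)
    (fun r => (hd r).deriv) t 0
  simp only [expFlow_zero, one_apply_eq_self] at h
  exact (pow_left_inj₀ (norm_nonneg _) (norm_nonneg _) two_ne_zero).1 h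

/-- Contractions that are pointwise Cauchy on a dense set converge strongly. -/
theorem exists_strong_limit {V : ℕ → H →L[ℂ] H} (hV : ∀ n x, ‖V n x‖ ≤ ‖x‖) {S : Set H}
    (hS : Dense S) (hc : ∀ x ∈ S, CauchySeq fun n => V n x) :
    ∃ U : H →L[ℂ] H, ∀ x, Tendsto (fun n => V n x) atTop (𝓝 (U x)) := by
  have hall : ∀ x, CauchySeq fun n => V n x := fun x => by
    rw [Metric.cauchySeq_iff']
    intro ε hε
    obtain ⟨y, hy, hxy⟩ := Metric.dense_iff.1 hS x (ε / 3) (by positivity)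
    rw [Metric.mem_ball, dist_eq_norm] at hy
    obtain ⟨N, hN⟩ := Metric.cauchySeq_iff'.1 (hc y hxy) (ε / 3) (by positivity)
    refine ⟨N, fun n hn => ?_⟩
    have h1 := hN n hn
    rw [dist_eq_norm] at h1 ⊢
    have e : V n x - V N x = -V n (y - x) + (V n y - V N y) + V N (y - x) := by
      simp only [map_sub]; abel
    rw [e]
    refine (norm_add₃_le).trans_lt ?_
    rw [norm_neg]
    linarith [hV n (y - x), hV N (y - x)]
  choose f hf using fun x => cauchySeq_tendsto_of_complete (hall x)
  exact ⟨continuousLinearMapOfTendsto V (tendsto_pi_nhds.2 hf), hf⟩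

end Flow

/-! ### Galerkin compressions of a diagonal pair -/

namespace DiagonalPair

variable {D : Submodule ℂ H} {A B : D →ₗ[ℂ] H} {φ : HilbertBasis ℕ ℂ H} {lam : ℕ → ℝ} {a b : ℝ}

theorem basis_mem (h : DiagonalPair D A B φ lam a b) (j : ℕ) : φ j ∈ D := by
  refine h.mem_of_coord _ ((-Complex.I * (lam j : ℂ)) • φ j) fun k => ?_
  rw [inner_smul_right, inner_basis]
  split_ifs with hk
  · rw [hk]
  · simp

theorem proj_mem (h : DiagonalPair D A B φ lam a b) (N : ℕ) (x : H) : proj φ N x ∈ D := by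
  rw [proj_apply]
  exact D.sum_mem fun j _ => D.smul_mem _ (h.basis_mem j)

theorem dense (h : DiagonalPair D A B φ lam a b) : Dense (D : Set H) := fun x =>
  mem_closure_of_tendsto (tendsto_proj φ x) (Eventually.of_forall fun N => h.proj_mem N x)

/-- `π_N` as a map into the domain. -/
noncomputable def projD (h : DiagonalPair D A B φ lam a b) (N : ℕ) : H →ₗ[ℂ] D :=
  LinearMap.codRestrict D (proj φ N : H →ₗ[ℂ] H) (h.proj_mem N)

theorem coe_projD (h : DiagonalPair D A B φ lam a b) (N : ℕ) (x : H) :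
    (h.projD N x : H) = proj φ N x := rfl

/-- The Galerkin compression `π_N T π_N`. -/
noncomputable def galerkinOp (h : DiagonalPair D A B φ lam a b) (T : D →ₗ[ℂ] H) (N : ℕ) :
    H →L[ℂ] H :=
  ∑ k ∈ Finset.range N, (innerSL ℂ (φ k)).smulRight (proj φ N (T ⟨φ k, h.basis_mem k⟩))

theorem galerkinOp_apply (h : DiagonalPair D A B φ lam a b) (T : D →ₗ[ℂ] H) (N : ℕ) (x : H) :
    h.galerkinOp T N x = proj φ N (T (h.projD N x)) := by
  have : h.projD N x = ∑ k ∈ Finset.range N, ⟪φ k, x⟫_ℂ • (⟨φ k, h.basis_mem k⟩ : D) := by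
    ext
    simp [coe_projD, proj_apply]
  rw [this, map_sum, map_sum, galerkinOp]
  simp only [map_smul, sum_apply, ContinuousLinearMap.smulRight_apply, innerSL_apply_apply]

theorem galerkinOp_add_smul (h : DiagonalPair D A B φ lam a b) (T S : D →ₗ[ℂ] H) (c : ℂ) (N : ℕ) :
    h.galerkinOp (T + c • S) N = h.galerkinOp T N + c • h.galerkinOp S N := by
  ext x
  simp [galerkinOp_apply]

theorem projD_proj (h : DiagonalPair D A B φ lam a b) (N : ℕ) (x : H) :
    h.projD N (proj φ N x) = h.projD N x :=
  Subtype.ext (proj_proj_of_le φ le_rfl x)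

theorem galerkinOp_commute_proj (h : DiagonalPair D A B φ lam a b) (T : D →ₗ[ℂ] H) (N : ℕ) :
    Commute (proj φ N) (h.galerkinOp T N) := by
  ext x
  simp only [mul_apply_eq_comp, galerkinOp_apply, projD_proj]
  exact proj_proj_of_le φ le_rfl _

theorem inner_galerkinOp (h : DiagonalPair D A B φ lam a b) {T : D →ₗ[ℂ] H}
    (hT : ∀ x y : D, ⟪T x, (y : H)⟫_ℂ = -⟪(x : H), T y⟫_ℂ) (N : ℕ) (x y : H) :
    ⟪h.galerkinOp T N x, y⟫_ℂ = -⟪x, h.galerkinOp T N y⟫_ℂ := by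
  rw [galerkinOp_apply, galerkinOp_apply, inner_proj_left, ← inner_proj_left φ N x]
  exact hT (h.projD N x) (h.projD N y)

theorem skew_diag (h : DiagonalPair D A B φ lam a b) (x y : D) :
    ⟪A x, (y : H)⟫_ℂ = -⟪(x : H), A y⟫_ℂ := by
  rw [← φ.tsum_inner_mul_inner, ← φ.tsum_inner_mul_inner, ← tsum_neg]
  refine tsum_congr fun j => ?_
  rw [h.coord, ← inner_conj_symm (A x), h.coord, ← inner_conj_symm (x : H)]
  simp only [map_neg, map_mul, Complex.conj_I, Complex.conj_ofReal]
  ring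

theorem skew_add (h : DiagonalPair D A B φ lam a b) (c : ℝ) (x y : D) :
    ⟪(A + (c : ℂ) • B) x, (y : H)⟫_ℂ = -⟪(x : H), (A + (c : ℂ) • B) y⟫_ℂ := by
  simp only [LinearMap.add_apply, LinearMap.smul_apply, inner_add_left, inner_add_right,
    inner_smul_left, inner_smul_right, h.skew_diag, h.skew, Complex.conj_ofReal]
  ring

theorem diag_projD (h : DiagonalPair D A B φ lam a b) (N : ℕ) (x : D) :
    A (h.projD N x) = proj φ N (A x) := by
  refine eq_of_inner_eq φ fun j => ?_
  rw [h.coord, inner_proj, coe_projD, inner_proj, h.coord]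
  split_ifs <;> simp

/-- For the `A` part, `π_N` commutes with `A`; for the unbounded `B` part the convergence is the
tail estimate. -/
theorem tendsto_add_projD (h : DiagonalPair D A B φ lam a b) (c : ℝ) (x : D) :
    Tendsto (fun N => (A + (c : ℂ) • B) (h.projD N x)) atTop (𝓝 ((A + (c : ℂ) • B) x)) := by
  have h1 : Tendsto (fun N => A (h.projD N x)) atTop (𝓝 (A x)) := by
    simp only [h.diag_projD]; exact tendsto_proj φ _
  refine h1.add (Tendsto.const_smul ?_ _)
  rw [Metric.tendsto_atTop]
  intro ε hε
  obtain ⟨N₀, hN₀⟩ := h.tail (ε / (‖A x‖ + 1)) (by positivity)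
  refine ⟨N₀, fun N hN => ?_⟩
  rw [dist_comm, dist_eq_norm, ← map_sub]
  calc _ ≤ ε / (‖A x‖ + 1) * ‖A x‖ := (hN₀ N hN x _ rfl).2
    _ < ε / (‖A x‖ + 1) * (‖A x‖ + 1) := by gcongr; linarith
    _ = ε := by field_simp

theorem norm_smul_le (h : DiagonalPair D A B φ lam a b) (c : ℝ) (x : D) :
    ‖(c : ℂ) • B x‖ ≤ |c| * a * ‖A x‖ + |c| * b * ‖(x : H)‖ := by
  rw [norm_smul, Complex.norm_real, Real.norm_eq_abs]
  calc |c| * ‖B x‖ ≤ |c| * (a * ‖A x‖ + b * ‖(x : H)‖) := by gcongr; exact h.relBound x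
    _ = _ := by ring

end DiagonalPair

/-! ### Convergence of the Galerkin flows for a constant control -/

namespace DiagonalPair

variable {D : Submodule ℂ H} {A B : D →ₗ[ℂ] H} {φ : HilbertBasis ℕ ℂ H} {lam : ℕ → ℝ} {a b : ℝ}

theorem projD_coe_projD (h : DiagonalPair D A B φ lam a b) (N : ℕ) (x : H) :
    h.projD N (h.projD N x : H) = h.projD N x := h.projD_proj N x

theorem proj_diag_projD (h : DiagonalPair D A B φ lam a b) (N : ℕ) (x : H) :
    proj φ N (A (h.projD N x)) = A (h.projD N x) := by
  rw [← h.diag_projD, projD_coe_projD]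

/-- The Galerkin flow started from a projected vector stays in the Galerkin space. -/
theorem proj_expFlow (h : DiagonalPair D A B φ lam a b) (T : D →ₗ[ℂ] H) (M : ℕ) (t : ℝ) (x : H) :
    proj φ M (expFlow (h.galerkinOp T M) t (proj φ M x)) =
      expFlow (h.galerkinOp T M) t (proj φ M x) := by
  have := congrArg (fun F : H →L[ℂ] H => F (proj φ M x))
    (expFlow_commute (h.galerkinOp_commute_proj T M) t).eq
  simp only [mul_apply_eq_comp] at this
  rw [this, proj_proj_of_le φ le_rfl]

variable [CompleteSpace H]

/-- The flow commutes with its generator `G` and is isometric, so `‖G y‖` keeps its initial value,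
which the graph norm of `ψ` bounds independently of `M` and `t`. The relative bound then recovers `A
y` from `G y`, the term `|c| a ‖A y‖` being absorbed on the left. -/
theorem norm_diag_expFlow_le (h : DiagonalPair D A B φ lam a b) (c : ℝ) (ψ : D) (M : ℕ) (t : ℝ) :
    (1 - |c| * a) *
      ‖A (h.projD M (expFlow (h.galerkinOp (A + (c : ℂ) • B) M) t (proj φ M ψ)))‖ ≤
      (1 + |c| * a) * ‖A ψ‖ + 2 * (|c| * b) * ‖(ψ : H)‖ := by
  have ha := h.a_pos.le
  have hb := h.b_nonneg
  set G := h.galerkinOp (A + (c : ℂ) • B) M with hG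
  set y := expFlow G t (proj φ M ψ) with hy
  have hn : ‖y‖ ≤ ‖(ψ : H)‖ := by
    rw [hy, norm_expFlow (h.inner_galerkinOp (h.skew_add c) M)]
    exact norm_proj_le φ M _
  have hGy : ‖G y‖ ≤ (1 + |c| * a) * ‖A ψ‖ + |c| * b * ‖(ψ : H)‖ := by
    have e : G y = expFlow G t (G (proj φ M ψ)) :=
      congrArg (fun F : H →L[ℂ] H => F (proj φ M ψ)) (expFlow_commute (Commute.refl G) t).eq
    rw [e, norm_expFlow (h.inner_galerkinOp (h.skew_add c) M), hG, galerkinOp_apply]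
    refine (norm_proj_le φ M _).trans ?_
    rw [projD_proj, LinearMap.add_apply, LinearMap.smul_apply]
    have h1 : ‖A (h.projD M ψ)‖ ≤ ‖A ψ‖ := by rw [h.diag_projD]; exact norm_proj_le φ M _
    have h2 : ‖(h.projD M ψ : H)‖ ≤ ‖(ψ : H)‖ := norm_proj_le φ M _
    calc _ ≤ ‖A (h.projD M ψ)‖ + ‖(c : ℂ) • B (h.projD M ψ)‖ := norm_add_le _ _
      _ ≤ ‖A ψ‖ + (|c| * a * ‖A ψ‖ + |c| * b * ‖(ψ : H)‖) := by
        refine add_le_add h1 ((h.norm_smul_le c _).trans ?_)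
        gcongr
      _ = _ := by ring
  have e : A (h.projD M y) = G y - proj φ M ((c : ℂ) • B (h.projD M y)) := by
    rw [hG, galerkinOp_apply, LinearMap.add_apply, map_add, proj_diag_projD]
    simp
  have h3 : ‖(c : ℂ) • B (h.projD M y)‖ ≤ |c| * a * ‖A (h.projD M y)‖ + |c| * b * ‖(ψ : H)‖ := by
    refine (h.norm_smul_le c _).trans ?_
    gcongr
    exact (norm_proj_le φ M _).trans hn
  have h4 := norm_sub_le (G y) (proj φ M ((c : ℂ) • B (h.projD M y)))
  rw [← e] at h4
  have h5 := norm_proj_le φ M ((c : ℂ) • B (h.projD M y))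
  linarith

/-- Galerkin flows of orders `N ≤ M` are close to each other. -/
theorem norm_expFlow_sub_le (h : DiagonalPair D A B φ lam a b) (c : ℝ) {K : ℝ} (ψ : D)
    (hψ : ∀ M t,
      ‖A (h.projD M (expFlow (h.galerkinOp (A + (c : ℂ) • B) M) t (proj φ M ψ)))‖ ≤ K)
    {ε : ℝ} {N M : ℕ} (hNM : N ≤ M)
    (hN : ∀ x y : D, (y : H) = x - proj φ N x → ‖(y : H)‖ ≤ ε * ‖A x‖ ∧ ‖B y‖ ≤ ε * ‖A x‖)
    (hε : 0 ≤ ε) (t : ℝ) :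
    ‖expFlow (h.galerkinOp (A + (c : ℂ) • B) M) t (proj φ M ψ) -
      expFlow (h.galerkinOp (A + (c : ℂ) • B) N) t (proj φ N ψ)‖ ≤ (|c| * |t| + 1) * (ε * K) := by
  set T := A + (c : ℂ) • B with hT
  set x : ℝ → H := fun t => expFlow (h.galerkinOp T M) t (proj φ M ψ) with hx
  set E := expFlow (h.galerkinOp T N) with hE
  have hxM : ∀ t, (h.projD M (x t) : H) = x t := fun t => h.proj_expFlow T M t ψ
  have hskew := h.inner_galerkinOp (h.skew_add c) N
  have hEE : ∀ s y, E s (E (-s) y) = y := fun s y => by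
    have := congrArg (fun F : H →L[ℂ] H => F y) (expFlow_add (h.galerkinOp T N) s (-s))
    simp only [add_neg_cancel, expFlow_zero, one_apply_eq_self, mul_apply_eq_comp] at this
    exact this.symm
  -- Duhamel's formula: the trajectory of order `M` is projected and pulled back by the flow of
  -- order `N`. The derivative is the pulled-back defect, in which the `A` terms cancel, leaving `c
  -- π_N B` applied to the tail of `x s`.
  have hd : ∀ s, HasDerivAt (fun r => E (-r) (proj φ N (x r)))
      (E (-s) (proj φ N (h.galerkinOp T M (x s)) - h.galerkinOp T N (proj φ N (x s)))) s := by
    intro s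
    have h1 : HasDerivAt (fun r => E (-r)) (-(E (-s) * h.galerkinOp T N)) s := by
      have := (hasDerivAt_expFlow (h.galerkinOp T N) (-s)).scomp s (hasDerivAt_neg s)
      exact this.congr_deriv (by simp [hE])
    have h2 : HasDerivAt (fun r => proj φ N (x r)) (proj φ N (h.galerkinOp T M (x s))) s :=
      ((proj φ N).restrictScalars ℝ).hasFDerivAt.comp_hasDerivAt s
        (hasDerivAt_expFlow_apply (h.galerkinOp T M) s (proj φ M ψ))
    have h3 := (((ContinuousLinearMap.restrictScalarsL ℂ H H ℝ ℝ).restrictScalars ℝ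
      ).hasFDerivAt.comp_hasDerivAt s h1).clm_apply h2
    refine h3.congr_deriv ?_
    simp only [map_sub]
    change -(E (-s) (h.galerkinOp T N (proj φ N (x s)))) + E (-s) _ = _
    abel
  have hb : ∀ s, ‖E (-s) (proj φ N (h.galerkinOp T M (x s)) - h.galerkinOp T N (proj φ N (x s)))‖ ≤
      |c| * (ε * K) := by
    intro s
    rw [hE, norm_expFlow hskew]
    set w := h.projD M (x s) with hw
    have e : proj φ N (h.galerkinOp T M (x s)) - h.galerkinOp T N (proj φ N (x s)) =
        proj φ N ((c : ℂ) • B (w - h.projD N (x s))) := by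
      rw [galerkinOp_apply, galerkinOp_apply, proj_proj_of_le φ hNM, projD_proj, ← map_sub,
        ← map_sub, hT, LinearMap.add_apply, map_add, LinearMap.smul_apply]
      have hA : proj φ N (A (w - h.projD N (x s))) = 0 := by
        have hw' : h.projD N (x s) = h.projD N (w : H) := by rw [hw, hxM]
        rw [hw', map_sub, map_sub, h.diag_projD, proj_proj_of_le φ le_rfl, sub_self]
      rw [hA, zero_add]
    rw [e]
    refine (norm_proj_le φ N _).trans ?_
    rw [norm_smul, Complex.norm_real, Real.norm_eq_abs]
    have h6 := (hN w (w - h.projD N (x s)) (by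
      rw [AddSubgroupClass.coe_sub, coe_projD h N, hw, hxM])).2
    have h7 := hψ M s
    gcongr
    exact h6.trans (by gcongr)
  have hW := Convex.norm_image_sub_le_of_norm_hasDerivWithin_le
    (fun s _ => (hd s).hasDerivWithinAt) (fun s _ => hb s) convex_univ (mem_univ 0) (mem_univ t)
  simp only [neg_zero, sub_zero, Real.norm_eq_abs] at hW
  have h0 : E 0 (proj φ N (x 0)) = proj φ N ψ := by
    simp only [hE, hx, expFlow_zero, one_apply_eq_self]
    exact proj_proj_of_le φ hNM _
  rw [h0, ← norm_expFlow hskew t, map_sub] at hW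
  rw [← hE, hEE] at hW
  have h8 := (hN (h.projD M (x t)) (h.projD M (x t) - h.projD N (x t)) (by
      rw [AddSubgroupClass.coe_sub, coe_projD h N, hxM])).1
  rw [AddSubgroupClass.coe_sub, coe_projD h N, hxM] at h8
  have h9 := mul_le_mul_of_nonneg_left (hψ M t) hε
  calc ‖x t - E t (proj φ N ψ)‖
      = ‖(x t - proj φ N (x t)) + (proj φ N (x t) - E t (proj φ N ψ))‖ := by rw [sub_add_sub_cancel]
    _ ≤ ε * K + |c| * (ε * K) * |t| := (norm_add_le _ _).trans (add_le_add (h8.trans h9) hW)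
    _ = _ := by ring

theorem cauchySeq_expFlow (h : DiagonalPair D A B φ lam a b) {c : ℝ} (hc : |c| * a < 1) (t : ℝ)
    (ψ : D) : CauchySeq fun N =>
      expFlow (h.galerkinOp (A + (c : ℂ) • B) N) t (proj φ N ψ) := by
  have ha := h.a_pos.le
  have hb := h.b_nonneg
  have hc' : 0 < 1 - |c| * a := sub_pos.2 hc
  set K := ((1 + |c| * a) * ‖A ψ‖ + 2 * (|c| * b) * ‖(ψ : H)‖) / (1 - |c| * a) with hK
  have hK0 : 0 ≤ K := by positivity
  have hψ : ∀ M t,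
      ‖A (h.projD M (expFlow (h.galerkinOp (A + (c : ℂ) • B) M) t (proj φ M ψ)))‖ ≤ K :=
    fun M t => by rw [hK, le_div_iff₀' hc']; exact h.norm_diag_expFlow_le c ψ M t
  rw [Metric.cauchySeq_iff']
  intro ε hε
  set η := ε / ((|c| * |t| + 1) * (K + 1)) with hη
  have hη0 : 0 < η := by positivity
  obtain ⟨N₀, hN₀⟩ := h.tail η hη0
  refine ⟨N₀, fun M hM => ?_⟩
  rw [dist_eq_norm]
  calc _ ≤ (|c| * |t| + 1) * (η * K) :=
        h.norm_expFlow_sub_le c ψ hψ hM (hN₀ N₀ le_rfl) hη0.le t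
    _ < (|c| * |t| + 1) * (η * (K + 1)) := by gcongr; linarith
    _ = ε := by rw [hη]; field_simp

end DiagonalPair

/-! ### Resolvent and unitary group of `A + cB` -/

namespace DiagonalPair

variable {D : Submodule ℂ H} {A B : D →ₗ[ℂ] H} {φ : HilbertBasis ℕ ℂ H} {lam : ℕ → ℝ} {a b : ℝ}

/-- The resolvent of the diagonal operator. -/
theorem exists_diag_resolvent (h : DiagonalPair D A B φ lam a b) {μ : ℝ} (hμ : 0 < μ) (g : H) :
    ∃ x : D, A x - (μ : ℂ) • (x : H) = g := by
  have hn : ∀ j, (lam j) ^ 2 ≤ ‖-Complex.I * (lam j : ℂ) - μ‖ ^ 2 ∧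
      μ ^ 2 ≤ ‖-Complex.I * (lam j : ℂ) - μ‖ ^ 2 := fun j => by
    rw [Complex.sq_norm, Complex.normSq_apply]
    constructor <;> simp <;> nlinarith
  have h0 : ∀ j, -Complex.I * (lam j : ℂ) - μ ≠ 0 := fun j h0 => by
    have := (hn j).2
    rw [h0] at this; simp at this; linarith
  have b1 : ∀ j, ‖(-Complex.I * (lam j : ℂ) - μ)⁻¹ * ⟪φ j, g⟫_ℂ‖ ≤ μ⁻¹ * ‖⟪φ j, g⟫_ℂ‖ := fun j => by
    rw [norm_mul, norm_inv]
    gcongr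
    exact le_of_sq_le_sq (hn j).2 (norm_nonneg _)
  have b2 : ∀ j, ‖(-Complex.I * (lam j : ℂ)) * ((-Complex.I * (lam j : ℂ) - μ)⁻¹ * ⟪φ j, g⟫_ℂ)‖ ≤
      1 * ‖⟪φ j, g⟫_ℂ‖ := fun j => by
    rw [← mul_assoc, norm_mul, norm_mul, norm_inv]
    gcongr
    rw [← div_eq_mul_inv]
    refine div_le_one_of_le₀ (le_of_sq_le_sq ?_ (norm_nonneg _)) (norm_nonneg _)
    refine le_of_eq_of_le ?_ (hn j).1
    simp
  obtain ⟨x, hx⟩ := exists_of_memℓp φ (memℓp_of_norm_le_inner φ b1)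
  obtain ⟨y, hy⟩ := exists_of_memℓp φ (memℓp_of_norm_le_inner φ b2)
  refine ⟨⟨x, h.mem_of_coord x y fun j => by rw [hy, hx]⟩, eq_of_inner_eq φ fun j => ?_⟩
  rw [inner_sub_right, h.coord, inner_smul_right, ← sub_mul, hx, mul_inv_cancel_left₀ (h0 j)]

theorem norm_sq_diag_sub (h : DiagonalPair D A B φ lam a b) (μ : ℝ) (x : D) :
    ‖A x - (μ : ℂ) • (x : H)‖ ^ 2 = ‖A x‖ ^ 2 + μ ^ 2 * ‖(x : H)‖ ^ 2 := by
  have hre : (⟪A x, (x : H)⟫_ℂ).re = 0 := by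
    have h1 := congrArg Complex.re (h.skew_diag x x)
    rw [← inner_conj_symm (x : H) (A x), Complex.neg_re, Complex.conj_re] at h1
    linarith
  rw [norm_sub_sq (𝕜 := ℂ), inner_smul_right, RCLike.re_to_complex, Complex.re_ofReal_mul, hre,
    norm_smul, Complex.norm_real, mul_pow, Real.norm_eq_abs, sq_abs]
  ring

variable [CompleteSpace H]

/-- With `R` the resolvent of `A` at `μ`, the equation becomes the fixed point problem `y = g - c B
(R y)`. Its Lipschitz constant `|c| a + |c| b / μ` is below `1` once `μ` is large, because `|c| a <
1`. -/
theorem exists_resolvent (h : DiagonalPair D A B φ lam a b) {c : ℝ} (hc : |c| * a < 1) :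
    ∃ μ : ℝ, 0 < μ ∧ ∀ g : H, ∃ x : D, (A + (c : ℂ) • B) x - (μ : ℂ) • (x : H) = g := by
  have ha := h.a_pos.le
  have hb := h.b_nonneg
  have hc' : 0 < 1 - |c| * a := sub_pos.2 hc
  set μ := 2 * (|c| * b + 1) / (1 - |c| * a) with hμ
  have hμ0 : 0 < μ := by positivity
  refine ⟨μ, hμ0, fun g => ?_⟩
  choose R hR using fun y => h.exists_diag_resolvent hμ0 y
  have hk0 : 0 ≤ |c| * a + |c| * b / μ := by positivity
  have hk : |c| * a + |c| * b / μ < 1 := by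
    have : |c| * b / μ < 1 - |c| * a := by
      rw [div_lt_iff₀ hμ0, hμ, mul_div_cancel₀ _ hc'.ne']
      nlinarith [mul_nonneg (abs_nonneg c) hb]
    linarith
  have hR1 : ∀ y y', ‖A (R y - R y')‖ ≤ ‖y - y'‖ ∧ ‖((R y - R y' : D) : H)‖ ≤ ‖y - y'‖ / μ := by
    intro y y'
    have e : A (R y - R y') - (μ : ℂ) • ((R y - R y' : D) : H) = y - y' := by
      rw [map_sub, AddSubgroupClass.coe_sub, smul_sub]
      nth_rw 3 [← hR y, ← hR y']
      abel
    have e2 := h.norm_sq_diag_sub μ (R y - R y')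
    rw [e] at e2
    constructor
    · refine le_of_sq_le_sq ?_ (norm_nonneg _)
      rw [e2]; nlinarith [mul_nonneg (sq_nonneg μ) (sq_nonneg ‖((R y - R y' : D) : H)‖)]
    · rw [le_div_iff₀ hμ0]
      refine le_of_sq_le_sq ?_ (norm_nonneg _)
      rw [e2]; nlinarith [sq_nonneg ‖A (R y - R y')‖]
  have hcontr : ContractingWith (⟨|c| * a + |c| * b / μ, hk0⟩ : NNReal)
      (fun y => g - (c : ℂ) • B (R y)) := by
    refine ⟨hk, LipschitzWith.of_dist_le_mul fun y y' => ?_⟩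
    rw [dist_eq_norm, sub_sub_sub_cancel_left, ← smul_sub, ← map_sub, dist_comm, dist_eq_norm]
    refine (h.norm_smul_le c _).trans ?_
    obtain ⟨h1, h2⟩ := hR1 y' y
    calc _ ≤ |c| * a * ‖y' - y‖ + |c| * b * (‖y' - y‖ / μ) := by gcongr
      _ = (|c| * a + |c| * b / μ) * ‖y' - y‖ := by ring
  have hfix := hcontr.fixedPoint_isFixedPt
  set y := hcontr.fixedPoint
  refine ⟨R y, ?_⟩
  have h3 : g - (c : ℂ) • B (R y) = y := hfix
  rw [LinearMap.add_apply, LinearMap.smul_apply, add_sub_right_comm, hR]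
  nth_rw 1 [← h3]
  abel

/-- The group is the strong limit of the Galerkin flows. Its generator extends `A + cB` by passing
to the limit in the integrated equation, and is not larger because `A + cB - μ` is already onto for
some `μ > 0`. -/
theorem exists_isUnitaryGroup (h : DiagonalPair D A B φ lam a b) {c : ℝ} (hc : |c| * a < 1) :
    ∃ U, IsUnitaryGroup (⟨D, A + (c : ℂ) • B⟩ : H →ₗ.[ℂ] H) U := by
  set T := A + (c : ℂ) • B with hT
  set E : ℕ → ℝ → H →L[ℂ] H := fun N => expFlow (h.galerkinOp T N) with hE
  set V : ℝ → ℕ → H →L[ℂ] H := fun t N => E N t * proj φ N with hV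
  have hEn : ∀ N t x, ‖E N t x‖ = ‖x‖ := fun N => norm_expFlow (h.inner_galerkinOp (h.skew_add c) N)
  have hVn : ∀ t N x, ‖V t N x‖ ≤ ‖x‖ := fun t N x => by
    rw [hV, mul_apply_eq_comp, hEn]; exact norm_proj_le φ N x
  choose U hU using fun t => exists_strong_limit (hVn t) h.dense
    fun x hx => h.cauchySeq_expFlow hc t ⟨x, hx⟩
  have hVU : ∀ t (x : ℕ → H) (y : H), Tendsto x atTop (𝓝 y) →
      Tendsto (fun N => V t N (x N)) atTop (𝓝 (U t y)) := by
    intro t x y hxy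
    have h1 : Tendsto (fun N => V t N (x N - y)) atTop (𝓝 0) :=
      squeeze_zero_norm (fun N => hVn t N _) (by simpa using (hxy.sub_const y).norm)
    have := h1.add (hU t y)
    simpa [map_sub] using this
  have map_zero : U 0 = 1 := by
    ext x
    refine tendsto_nhds_unique (hU 0 x) ?_
    simpa [hV, hE, expFlow_zero] using tendsto_proj φ x
  have isometric : ∀ t x, ‖U t x‖ = ‖x‖ := fun t x => by
    refine tendsto_nhds_unique (hU t x).norm ?_
    simp only [hV, mul_apply_eq_comp, hEn]
    exact (tendsto_proj φ x).norm
  have map_sum : ∀ s t, U (s + t) = U s ∘L U t := fun s t => by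
    ext x
    refine tendsto_nhds_unique (hU (s + t) x) ?_
    have := hVU s _ _ (hU t x)
    refine this.congr fun N => ?_
    simp only [hV, hE, mul_apply_eq_comp, expFlow_add, h.proj_expFlow]
  have hmeas : ∀ x, AEStronglyMeasurable (fun t => U t x) := fun x => by
    refine aestronglyMeasurable_of_tendsto_ae atTop (f := fun N t => V t N x) (fun N => ?_)
      (ae_of_all _ fun t => hU t x)
    have : Continuous fun t => V t N x := continuous_iff_continuousAt.2 fun t =>
      (hasDerivAt_expFlow_apply (h.galerkinOp T N) t (proj φ N x)).continuousAt
    exact this.aestronglyMeasurable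
  -- The integrated equation survives the limit by dominated convergence, since `T (π_N ψ) → T ψ`.
  -- It gives at once continuity of the orbits of `D` and their derivative at `0`.
  have hint : ∀ (ψ : D) t, U t ψ = ψ + ∫ s in (0 : ℝ)..t, U s (T ψ) := by
    intro ψ t
    set g : ℕ → H := fun N => T (h.projD N ψ) with hg
    have hgT : Tendsto g atTop (𝓝 (T ψ)) := h.tendsto_add_projD c ψ
    obtain ⟨K, hK⟩ := hgT.norm.bddAbove_range
    have hNint : ∀ N, V t N ψ = proj φ N ψ + ∫ s in (0 : ℝ)..t, V s N (g N) := by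
      intro N
      have hd : ∀ s, HasDerivAt (fun s => V s N ψ) (V s N (g N)) s := fun s => by
        have := hasDerivAt_expFlow_apply (h.galerkinOp T N) s (proj φ N ψ)
        have e := congrArg (fun F : H →L[ℂ] H => F (proj φ N ψ))
          (expFlow_commute (Commute.refl (h.galerkinOp T N)) s).eq
        simp only [mul_apply_eq_comp] at e
        rw [e, galerkinOp_apply, projD_proj] at this
        exact this
      have hcont : Continuous fun s => V s N (g N) := continuous_iff_continuousAt.2 fun t =>
        (hasDerivAt_expFlow_apply (h.galerkinOp T N) t (proj φ N (g N))).continuousAt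
      rw [intervalIntegral.integral_eq_sub_of_hasDerivAt (fun s _ => hd s)
        (hcont.intervalIntegrable _ _)]
      simp [hV, hE, expFlow_zero]
    refine tendsto_nhds_unique (hU t ψ) ?_
    simp only [hNint]
    refine (tendsto_proj φ _).add ?_
    refine intervalIntegral.tendsto_integral_filter_of_dominated_convergence (fun _ => K)
      (Eventually.of_forall fun N => ?_) (Eventually.of_forall fun N => ae_of_all _ fun s _ =>
        (hVn s N _).trans (hK ⟨N, rfl⟩)) (by simp) (ae_of_all _ fun s _ => hVU s _ _ hgT)
    have hcont : Continuous fun s => V s N (g N) := continuous_iff_continuousAt.2 fun t =>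
      (hasDerivAt_expFlow_apply (h.galerkinOp T N) t (proj φ N (g N))).continuousAt
    exact hcont.aestronglyMeasurable
  have hUint : ∀ x p q, IntervalIntegrable (fun s => U s x) volume p q := fun x p q =>
    IntervalIntegrable.mono_fun (f := fun _ => ‖x‖) (by simp) (hmeas x).restrict
      (ae_of_all _ fun s => by simp [isometric])
  have hcontD : ∀ ψ : D, Continuous fun t => U t ψ := fun ψ => by
    simp only [hint ψ]
    exact continuous_const.add (intervalIntegral.continuous_primitive (hUint (T ψ)) 0)
  have cont : ∀ x, Continuous fun t => U t x := fun x => by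
    refine continuous_of_uniform_approx_of_continuous fun S hS => ?_
    obtain ⟨ε, hε, hS⟩ := Metric.mem_uniformity_dist.1 hS
    obtain ⟨y, hy, hyD⟩ := Metric.dense_iff.1 h.dense x ε hε
    refine ⟨fun t => U t y, hcontD ⟨y, hyD⟩, fun t => hS ?_⟩
    rw [dist_eq_norm, ← map_sub, isometric, ← dist_eq_norm, dist_comm]
    exact hy
  have hderiv : ∀ ψ : D, HasDerivAt (fun t => U t ψ) (T ψ) 0 := fun ψ => by
    have h1 := (intervalIntegral.integral_hasDerivAt_right (hUint (T ψ) 0 0)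
      ((cont (T ψ)).stronglyMeasurableAtFilter _ _) (cont (T ψ)).continuousAt).const_add (ψ : H)
    rw [map_zero, one_apply_eq_self] at h1
    simpa only [← hint ψ] using h1
  refine ⟨U, map_zero, map_sum, isometric, cont, fun ψ η => ⟨fun hη => ?_, ?_⟩⟩
  -- Surjectivity provides `x ∈ D` such that the generator maps `ψ - x` to `μ (ψ - x)`. Since the
  -- norm is conserved along orbits, `0 = 2 μ ‖ψ - x‖²`, whence `ψ = x ∈ D`.
  · obtain ⟨μ, hμ, hr⟩ := h.exists_resolvent hc
    obtain ⟨x, hx⟩ := hr (η - (μ : ℂ) • ψ)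
    have h1 : HasDerivAt (fun t => U t (ψ - x)) ((μ : ℂ) • (ψ - x)) 0 := by
      have := hη.sub (hderiv x)
      have e : η - T x = (μ : ℂ) • (ψ - (x : H)) := by
        rw [sub_eq_iff_eq_add] at hx
        rw [hT, hx, smul_sub]; abel
      rw [e] at this
      simpa [Pi.sub_def] using this
    have h2 := hasDerivAt_norm_sq h1
    simp only [isometric, map_zero, one_apply_eq_self] at h2
    have h3 := h2.unique (hasDerivAt_const _ _)
    rw [inner_smul_right, Complex.re_ofReal_mul, ← RCLike.re_to_complex,
      inner_self_eq_norm_sq] at h3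
    have h4 : ψ = x := by
      have : ‖ψ - x‖ ^ 2 = 0 := by
        rcases mul_eq_zero.1 h3 with h | h
        · norm_num at h
        · exact (mul_eq_zero.1 h).resolve_left hμ.ne'
      rwa [sq_eq_zero_iff, norm_eq_zero, sub_eq_zero] at this
    refine ⟨h4 ▸ x.2, ?_⟩
    have h5 := hη.unique (h4 ▸ hderiv x : HasDerivAt (fun t => U t ψ) (T x) 0)
    rw [h5]
    exact congrArg T (Subtype.ext h4)
  · rintro ⟨hψ, rfl⟩
    exact hderiv ⟨ψ, hψ⟩

end DiagonalPair

/-! ### Approximation of controls by step controls -/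

/-- A function that is constant on the gaps of a finite set has a propagator. -/
theorem exists_stepPropagator {A B : H →ₗ.[ℂ] H} {w : ℝ → ℝ} {P : Finset ℝ}
    (hw : ∀ s t, (∀ p ∈ P, p ∉ Ioo s t) → ∀ r ∈ Ioo s t, ∀ r' ∈ Ioo s t, w r = w r')
    (hU : ∀ r, ∃ U, IsUnitaryGroup (A + (w r : ℂ) • B) U) {t : ℝ} (ht : 0 ≤ t) :
    ∃ V, StepPropagator A B w t V := by
  have step : ∀ s t, s ≤ t → (∀ p ∈ P, p ∉ Ioo s t) → ∀ V, StepPropagator A B w s V →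
      ∃ V, StepPropagator A B w t V := by
    intro s t hst hP V hV
    obtain ⟨U, hU⟩ := hU ((s + t) / 2)
    have := StepPropagator.step hV (t - s) (w ((s + t) / 2)) (sub_nonneg.2 hst) (fun r hr => by
      rw [add_sub_cancel] at hr
      exact hw s t hP r hr _ ⟨by linarith [hr.1, hr.2], by linarith [hr.1, hr.2]⟩) U hU
    rw [add_sub_cancel] at this
    exact ⟨_, this⟩
  -- Induction on the number of breakpoints inside `(0, t)`, splitting off the interval after the
  -- last one.
  suffices H : ∀ n : ℕ, ∀ t, 0 ≤ t → (P.filter (· ∈ Ioo 0 t)).card ≤ n →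
      ∃ V, StepPropagator A B w t V from H _ t ht le_rfl
  intro n
  induction n with
  | zero =>
    intro t ht hn
    rw [Nat.le_zero, Finset.card_eq_zero, Finset.filter_eq_empty_iff] at hn
    exact step 0 t ht (fun p hp => hn hp) 1 StepPropagator.zero
  | succ n ih =>
    intro t ht hn
    rcases (P.filter (· ∈ Ioo 0 t)).eq_empty_or_nonempty with he | hne
    · exact step 0 t ht (fun p hp => (Finset.filter_eq_empty_iff.1 he) hp) 1 StepPropagator.zero
    · set q := (P.filter (· ∈ Ioo 0 t)).max' hne with hq
      have hqm := Finset.max'_mem _ hne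
      rw [← hq, Finset.mem_filter] at hqm
      obtain ⟨V, hV⟩ := ih q hqm.2.1.le (by
        refine Nat.le_of_lt_succ (lt_of_lt_of_le (Finset.card_lt_card ?_) hn)
        refine Finset.ssubset_iff_of_subset (fun p hp => ?_) |>.2
          ⟨q, Finset.mem_filter.2 hqm, fun h => lt_irrefl q (Finset.mem_filter.1 h).2.2⟩
        rw [Finset.mem_filter] at hp ⊢
        exact ⟨hp.1, hp.2.1, hp.2.2.trans hqm.2.2⟩)
      refine step q t hqm.2.2.le (fun p hp hpq => ?_) V hV
      exact absurd (Finset.le_max' _ p (Finset.mem_filter.2 ⟨hp, hqm.2.1.trans hpq.1, hpq.2⟩))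
        (not_le.2 hpq.1)

/-- The monotone step function that sends each gap of `P` to its midpoint and fixes `P`. -/
noncomputable def gapMid (P : Finset ℝ) (hP : P.Nonempty) (T t : ℝ) : ℝ :=
  (P.sup' hP (fun p => if p ≤ t then p else 0) + P.inf' hP (fun p => if t ≤ p then p else T)) / 2

section GapMid

variable {P : Finset ℝ} {hP : P.Nonempty} {T : ℝ}

/-- As the argument grows, each entry of the supremum switches at most once, from the default `0` up
to `p ≥ 0`, and each entry of the infimum at most once, from `p` up to the default `T ≥ p`. -/
theorem monotone_gapMid (hPT : ∀ p ∈ P, p ∈ Icc 0 T) : Monotone (gapMid P hP T) := by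
  intro s t hst
  unfold gapMid
  have h1 : P.sup' hP (fun p => if p ≤ s then p else 0) ≤
      P.sup' hP (fun p => if p ≤ t then p else 0) := by
    refine Finset.sup'_mono_fun fun p hp => ?_
    have := (hPT p hp).1
    split_ifs <;> linarith
  have h2 : P.inf' hP (fun p => if s ≤ p then p else T) ≤
      P.inf' hP (fun p => if t ≤ p then p else T) := by
    refine Finset.inf'_mono_fun fun p hp => ?_
    have := (hPT p hp).2
    split_ifs <;> linarith
  linarith

theorem gapMid_eq_of_gap {s t r r' : ℝ} (hst : ∀ p ∈ P, p ∉ Ioo s t) (hr : r ∈ Ioo s t)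
    (hr' : r' ∈ Ioo s t) : gapMid P hP T r = gapMid P hP T r' := by
  have key : ∀ p ∈ P, (p ≤ r ↔ p ≤ r') ∧ (r ≤ p ↔ r' ≤ p) := fun p hp => by
    have := hst p hp
    simp only [mem_Ioo, not_and, not_lt] at this hr hr'
    by_cases h : s < p
    · have := this h
      constructor <;> constructor <;> intro <;> linarith
    · constructor <;> constructor <;> intro <;> linarith
  unfold gapMid
  congr 2
  · exact Finset.sup'_congr hP rfl fun p hp => by simp only [(key p hp).1]
  · exact Finset.inf'_congr hP rfl fun p hp => by simp only [(key p hp).2]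

theorem le_gapMid {p t : ℝ} (hp : p ∈ P) (hpt : p ≤ t) (htT : t ≤ T) : p ≤ gapMid P hP T t := by
  have h1 : p ≤ P.sup' hP (fun p => if p ≤ t then p else 0) := by
    have := Finset.le_sup' (fun p => if p ≤ t then p else 0) hp
    rwa [if_pos hpt] at this
  have h2 : t ≤ P.inf' hP (fun p => if t ≤ p then p else T) := by
    refine Finset.le_inf' _ _ fun q _ => ?_
    split_ifs <;> assumption
  unfold gapMid
  linarith

theorem gapMid_le {p t : ℝ} (hp : p ∈ P) (hpt : t ≤ p) (ht : 0 ≤ t) : gapMid P hP T t ≤ p := by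
  have h1 : P.inf' hP (fun p => if t ≤ p then p else T) ≤ p := by
    have := Finset.inf'_le (fun p => if t ≤ p then p else T) hp
    rwa [if_pos hpt] at this
  have h2 : P.sup' hP (fun p => if p ≤ t then p else 0) ≤ t := by
    refine Finset.sup'_le _ _ fun q _ => ?_
    split_ifs <;> assumption
  unfold gapMid
  linarith

theorem gapMid_of_mem {t : ℝ} (ht : t ∈ P) (htT : t ∈ Icc 0 T) : gapMid P hP T t = t :=
  le_antisymm (gapMid_le ht le_rfl htT.1) (le_gapMid ht le_rfl htT.2)

theorem gapMid_of_nonpos (hPT : ∀ p ∈ P, p ∈ Icc 0 T) (h0 : 0 ∈ P) {t : ℝ} (ht : t ≤ 0) :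
    gapMid P hP T t = 0 := by
  have h1 : P.sup' hP (fun p => if p ≤ t then p else 0) = 0 := by
    rw [Finset.sup'_congr hP rfl (g := fun _ => (0 : ℝ)), Finset.sup'_const]
    intro p hp
    have := (hPT p hp).1
    split_ifs <;> linarith
  have h2 : P.inf' hP (fun p => if t ≤ p then p else T) ≤ 0 := by
    have := Finset.inf'_le (fun p => if t ≤ p then p else T) h0
    rwa [if_pos ht] at this
  have h3 : 0 ≤ P.inf' hP (fun p => if t ≤ p then p else T) := by
    refine Finset.le_inf' _ _ fun q hq => ?_
    have := hPT q hq
    split_ifs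
    · exact this.1
    · exact this.1.trans this.2
  unfold gapMid
  linarith

end GapMid

theorem countable_not_continuousAt_of_boundedVariationOn {u : ℝ → ℝ}
    (hu : BoundedVariationOn u univ) : {t | ¬ContinuousAt u t}.Countable := by
  obtain ⟨p, q, hp, hq, rfl⟩ := hu.locallyBoundedVariationOn.exists_monotoneOn_sub_monotoneOn
  rw [monotoneOn_univ] at hp hq
  refine (hp.countable_not_continuousAt.union hq.countable_not_continuousAt).mono fun t ht => ?_
  by_contra hcon
  simp only [mem_union, mem_ofPred_eq, not_or, not_not] at hcon
  exact ht (hcon.1.sub hcon.2)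

theorem measurable_of_boundedVariationOn {u : ℝ → ℝ} (hu : BoundedVariationOn u univ) :
    Measurable u := by
  obtain ⟨p, q, hp, hq, rfl⟩ := hu.locallyBoundedVariationOn.exists_monotoneOn_sub_monotoneOn
  rw [monotoneOn_univ] at hp hq
  exact hp.measurable.sub hq.measurable

/-- The approximations are `u ∘ ρ n` with `ρ n` monotone and piecewise constant. Composition with a
monotone map keeps the range of values and cannot increase the variation. The breakpoints exhaust
the rationals of `[0, T]`, so `ρ n t → t`, which suffices where `u` is continuous. They also exhaust
the countably many discontinuities of `u` there, where `ρ n t = t` eventually. -/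
theorem exists_isStepApproximation {A B : H →ₗ.[ℂ] H} {δ a : ℝ} {u : ℝ → ℝ} (hu : u ∈ controls δ a)
    (hU : ∀ t, ∃ U, IsUnitaryGroup (A + (u t : ℂ) • B) U) {T : ℝ} (hT : 0 ≤ T) :
    ∃ un Υn, IsStepApproximation A B δ a u T un Υn := by
  obtain ⟨hbv, hu0, hmem⟩ := hu
  obtain ⟨q, hq⟩ := Set.Countable.exists_eq_range
    ((countable_not_continuousAt_of_boundedVariationOn hbv).union
      (countable_range ((↑) : ℚ → ℝ))) ⟨((0 : ℚ) : ℝ), Or.inr ⟨0, rfl⟩⟩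
  -- Clamping moves the points outside `[0, T]` to the endpoints, which belong to `P n` anyway.
  set P : ℕ → Finset ℝ := fun n =>
    insert 0 (insert T ((Finset.range n).image fun k => max 0 (min (q k) T))) with hPdef
  have hPT : ∀ n, ∀ p ∈ P n, p ∈ Icc 0 T := by
    intro n p hp
    simp only [hPdef, Finset.mem_insert, Finset.mem_image] at hp
    rcases hp with rfl | rfl | ⟨k, _, rfl⟩
    · exact ⟨le_rfl, hT⟩
    · exact ⟨hT, le_rfl⟩
    · exact ⟨le_max_left _ _, max_le hT (min_le_right _ _)⟩
  have h0 : ∀ n, 0 ∈ P n := fun n => Finset.mem_insert_self _ _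
  have hTm : ∀ n, T ∈ P n := fun n => Finset.mem_insert_of_mem (Finset.mem_insert_self _ _)
  have hqP : ∀ t ∈ Icc 0 T, t ∈ range q → ∀ᶠ n in atTop, t ∈ P n := by
    rintro t ht ⟨k, rfl⟩
    filter_upwards [eventually_gt_atTop k] with n hn
    simp only [hPdef, Finset.mem_insert, Finset.mem_image, Finset.mem_range]
    exact Or.inr (Or.inr ⟨k, hn, by rw [min_eq_left ht.2, max_eq_right ht.1]⟩)
  set ρ : ℕ → ℝ → ℝ := fun n => gapMid (P n) (⟨0, h0 n⟩ : (P n).Nonempty) T with hρ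
  have hρm : ∀ n, Monotone (ρ n) := fun n => monotone_gapMid (hPT n)
  have hρI : ∀ n, ∀ t ∈ Icc 0 T, ρ n t ∈ Icc 0 T := fun n t ht =>
    ⟨le_gapMid (h0 n) ht.1 ht.2, gapMid_le (hTm n) ht.2 ht.1⟩
  have hstep : ∀ n t, 0 ≤ t → ∃ V, StepPropagator A B (u ∘ ρ n) t V := fun n t ht =>
    exists_stepPropagator (P := P n)
      (fun s t hst r hr r' hr' => congrArg u (gapMid_eq_of_gap hst hr hr')) (fun r => hU _) ht
  have hρt : ∀ t ∈ Icc 0 T, Tendsto (fun n => ρ n t) atTop (𝓝 t) := by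
    intro t ht
    refine tendsto_order.2 ⟨fun c hc => ?_, fun c hc => ?_⟩
    · rcases lt_or_ge c 0 with hc0 | hc0
      · exact Eventually.of_forall fun n => hc0.trans_le (hρI n t ht).1
      · obtain ⟨r, hr1, hr2⟩ := exists_rat_btwn hc
        filter_upwards [hqP r ⟨by linarith, by linarith [ht.2]⟩ (hq ▸ Or.inr ⟨r, rfl⟩)] with n hn
        exact hr1.trans_le (le_gapMid hn hr2.le ht.2)
    · rcases lt_or_ge T c with hc0 | hc0
      · exact Eventually.of_forall fun n => (hρI n t ht).2.trans_lt hc0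
      · obtain ⟨r, hr1, hr2⟩ := exists_rat_btwn hc
        filter_upwards [hqP r ⟨by linarith [ht.1], by linarith⟩ (hq ▸ Or.inr ⟨r, rfl⟩)] with n hn
        exact (gapMid_le hn hr1.le ht.1).trans_lt hr2
  choose! Υn hΥn using hstep
  refine ⟨fun n => u ∘ ρ n, Υn, fun n => ⟨?_, fun t ht => ?_, fun t => hmem _⟩,
    fun n t ht => hΥn n t ht.1, fun t ht => ?_, fun n => ?_⟩
  · exact ne_top_of_le_ne_top hbv
      (eVariationOn.comp_le_of_monotoneOn u _ ((hρm n).monotoneOn _) (mapsTo_univ _ _))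
  · exact (congrArg u (gapMid_of_nonpos (hPT n) (h0 n) ht)).trans (hu0 0 le_rfl)
  · by_cases hc : ContinuousAt u t
    · exact hc.tendsto.comp (hρt t ht)
    · refine tendsto_const_nhds.congr' ?_
      filter_upwards [hqP t ht (hq ▸ Or.inl hc)] with n hn
      exact (congrArg u (gapMid_of_mem hn ht)).symm
  · exact eVariationOn.comp_le_of_monotoneOn u _ ((hρm n).monotoneOn _) fun t ht => hρI n t ht

/-! ### Growth of the energy along step propagators -/

namespace IsUnitaryGroup

variable {T : H →ₗ.[ℂ] H} {U : ℝ → H →L[ℂ] H}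

theorem hasDerivAt (hU : IsUnitaryGroup T U) (ψ : T.domain) (t : ℝ) :
    HasDerivAt (fun r => U r ψ) (U t (T ψ)) t := by
  have h0 : HasDerivAt (fun r => U r ψ) (T ψ) (t - t) := by
    rw [sub_self]; exact (hU.generator ψ _).2 ⟨ψ.2, rfl⟩
  have h1 := ((U t).restrictScalars ℝ).hasFDerivAt.comp_hasDerivAt t (h0.comp_sub_const t t)
  refine h1.congr_of_eventuallyEq (Eventually.of_forall fun r => ?_)
  have := congrArg (fun F : H →L[ℂ] H => F ψ) (hU.map_sum t (r - t))
  simpa using this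

theorem exists_apply (hU : IsUnitaryGroup T U) (ψ : T.domain) (t : ℝ) :
    ∃ h : U t ψ ∈ T.domain, T ⟨U t ψ, h⟩ = U t (T ψ) := by
  refine (hU.generator _ _).1 ?_
  have h1 : HasDerivAt (fun r => U r ψ) (U t (T ψ)) (0 + t) := by
    rw [zero_add]; exact hU.hasDerivAt ψ t
  refine (h1.comp_add_const 0 t).congr_of_eventuallyEq (Eventually.of_forall fun r => ?_)
  exact (congrArg (fun F : H →L[ℂ] H => F ψ) (hU.map_sum r t)).symm

end IsUnitaryGroup

theorem StepPropagator.nonneg {A B : H →ₗ.[ℂ] H} {w : ℝ → ℝ} {s : ℝ} {V : H →L[ℂ] H}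
    (hV : StepPropagator A B w s V) : 0 ≤ s := by
  induction hV with
  | zero => exact le_rfl
  | step _ τ _ hτ _ _ _ ih => exact add_nonneg ih hτ

theorem StepPropagator.norm_apply {A B : H →ₗ.[ℂ] H} {w : ℝ → ℝ} {s : ℝ} {V : H →L[ℂ] H}
    (hV : StepPropagator A B w s V) (x : H) : ‖V x‖ = ‖x‖ := by
  induction hV with
  | zero => rfl
  | step _ τ _ _ _ U hU ih => rw [ContinuousLinearMap.comp_apply, hU.isometric, ih]

/-- The total variation of `w` on `[0, t]`. -/
noncomputable def variationUpTo (w : ℝ → ℝ) (t : ℝ) : ℝ := (eVariationOn w (Icc 0 t)).toReal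

theorem abs_sub_add_variationUpTo_le {w : ℝ → ℝ} (hw : BoundedVariationOn w univ) {p q : ℝ}
    (hp : 0 ≤ p) (hpq : p ≤ q) :
    |w q - w p| + variationUpTo w p ≤ variationUpTo w q := by
  have hfin : ∀ s t, eVariationOn w (Icc s t) ≠ ⊤ := fun s t =>
    ne_top_of_le_ne_top hw (eVariationOn.mono w (subset_univ _))
  have h1 := eVariationOn.Icc_add_Icc w (s := univ) hp hpq (mem_univ p)
  simp only [univ_inter] at h1
  have h2 := eVariationOn.edist_le w (right_mem_Icc.2 hpq) (left_mem_Icc.2 hpq)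
  rw [edist_dist, ENNReal.ofReal_le_iff_le_toReal (hfin _ _), Real.dist_eq] at h2
  rw [variationUpTo, variationUpTo, ← h1, ENNReal.toReal_add (hfin _ _) (hfin _ _)]
  linarith

/-- The generator `A + cB` on `D(A)`. -/
def genOn {A B : H →ₗ.[ℂ] H} (hAB : A.domain ≤ B.domain) (c : ℝ) : A.domain →ₗ[ℂ] H :=
  A.toFun + (c : ℂ) • restrictTo B hAB

theorem add_smul_eq {A B : H →ₗ.[ℂ] H} (hAB : A.domain ≤ B.domain) (c : ℝ) :
    A + (c : ℂ) • B = ⟨A.domain, genOn hAB c⟩ := by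
  have hd : (A + (c : ℂ) • B).domain = A.domain := by
    rw [LinearPMap.add_domain, LinearPMap.smul_domain]; exact inf_eq_left.2 hAB
  refine LinearPMap.dExt hd fun x y hxy => ?_
  obtain ⟨x, hx⟩ := x
  obtain ⟨y, hy⟩ := y
  obtain rfl : x = y := hxy
  rfl

theorem abs_mul_lt_of_mem_controls {u : ℝ → ℝ} {δ a : ℝ} (ha : 0 < a) (hu : u ∈ controls δ a)
    (t : ℝ) : |u t| * a < 1 - δ := by
  rw [← lt_div_iff₀ ha]
  exact abs_lt.2 (hu.2.2 t)

namespace DiagonalPair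

variable {A B : H →ₗ.[ℂ] H} {hAB : A.domain ≤ B.domain} {φ : HilbertBasis ℕ ℂ H} {lam : ℕ → ℝ}
  {a b δ : ℝ}

/-- The energy `‖(A + cB)x‖ + (2b/a)‖x‖`. -/
noncomputable def energy (_ : DiagonalPair A.domain A.toFun (restrictTo B hAB) φ lam a b) (c : ℝ)
    (x : A.domain) : ℝ :=
  ‖genOn hAB c x‖ + 2 * b / a * ‖(x : H)‖

theorem energy_nonneg (h : DiagonalPair A.domain A.toFun (restrictTo B hAB) φ lam a b) (c : ℝ)
    (x : A.domain) : 0 ≤ h.energy c x := by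
  have := h.a_pos; have := h.b_nonneg
  unfold energy; positivity

/-- The weight `2b/a` in the energy is chosen for this: `|c| b ≤ b/a`, so one half absorbs the lower
order term of the relative bound, and the other half is kept to control `b ‖x‖` when `B` is
estimated. -/
theorem norm_le_energy (h : DiagonalPair A.domain A.toFun (restrictTo B hAB) φ lam a b)
    (hδ : δ ∈ Ioo (0 : ℝ) 1) {c : ℝ} (hc : |c| * a ≤ 1 - δ) (x : A.domain) :
    δ * ‖A x‖ + b / a * ‖(x : H)‖ ≤ h.energy c x := by
  have ha := h.a_pos; have hb := h.b_nonneg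
  have h1 := h.norm_smul_le c x
  have h2 : ‖A x‖ ≤ ‖genOn hAB c x‖ + ‖(c : ℂ) • restrictTo B hAB x‖ := by
    have : A x = genOn hAB c x - (c : ℂ) • restrictTo B hAB x := (add_sub_cancel_right _ _).symm
    rw [this]; exact norm_sub_le _ _
  have h3 : |c| * b ≤ b / a := by
    rw [le_div_iff₀ ha]
    nlinarith [hδ.1]
  have h4 : |c| * a * ‖A x‖ ≤ (1 - δ) * ‖A x‖ := by gcongr
  have h5 : |c| * b * ‖(x : H)‖ ≤ b / a * ‖(x : H)‖ := by gcongr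
  have h6 : 2 * b / a = b / a + b / a := by ring
  unfold energy
  rw [h6]
  change ‖(c : ℂ) • restrictTo B hAB x‖ ≤ |c| * a * ‖A x‖ + _ at h1
  linarith

theorem norm_restrict_le_energy
    (h : DiagonalPair A.domain A.toFun (restrictTo B hAB) φ lam a b)
    (hδ : δ ∈ Ioo (0 : ℝ) 1) {c : ℝ} (hc : |c| * a ≤ 1 - δ) (x : A.domain) :
    ‖restrictTo B hAB x‖ ≤ a / δ * h.energy c x := by
  have ha := h.a_pos; have hb := h.b_nonneg; have hδ0 := hδ.1
  have h1 := h.norm_le_energy hδ hc x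
  have h2 : ‖restrictTo B hAB x‖ ≤ a * ‖A x‖ + b * ‖(x : H)‖ := h.relBound x
  calc _ ≤ a * ‖A x‖ + b * ‖(x : H)‖ := h2
    _ ≤ a * ‖A x‖ + b / δ * ‖(x : H)‖ := by
      gcongr; exact le_div_self hb hδ0 hδ.2.le
    _ = a / δ * (δ * ‖A x‖ + b / a * ‖(x : H)‖) := by field_simp
    _ ≤ _ := by gcongr

theorem energy_le_energy (h : DiagonalPair A.domain A.toFun (restrictTo B hAB) φ lam a b)
    (hδ : δ ∈ Ioo (0 : ℝ) 1) {c : ℝ} (hc : |c| * a ≤ 1 - δ) (c' : ℝ) (x : A.domain) :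
    h.energy c' x ≤ Real.exp (a / δ * |c' - c|) * h.energy c x := by
  have h1 := h.norm_restrict_le_energy hδ hc x
  have h2 : ‖genOn hAB c' x‖ ≤ ‖genOn hAB c x‖ + |c' - c| * ‖restrictTo B hAB x‖ := by
    have e : genOn hAB c' x = genOn hAB c x + ((c' - c : ℝ) : ℂ) • restrictTo B hAB x := by
      simp only [genOn, LinearMap.add_apply, LinearMap.smul_apply, Complex.ofReal_sub, sub_smul]
      abel
    rw [e]
    refine (norm_add_le _ _).trans ?_
    rw [norm_smul, Complex.norm_real, Real.norm_eq_abs]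
  calc h.energy c' x ≤ h.energy c x + |c' - c| * ‖restrictTo B hAB x‖ := by unfold energy; linarith
    _ ≤ h.energy c x + |c' - c| * (a / δ * h.energy c x) := by gcongr
    _ = (a / δ * |c' - c| + 1) * h.energy c x := by ring
    _ ≤ _ := mul_le_mul_of_nonneg_right (Real.add_one_le_exp _) (h.energy_nonneg c x)

/-- Growth of the energy along a step propagator is controlled by the total variation. -/
theorem energy_stepPropagator (h : DiagonalPair A.domain A.toFun (restrictTo B hAB) φ lam a b)
    (hδ : δ ∈ Ioo (0 : ℝ) 1) {w : ℝ → ℝ} (hw : w ∈ controls δ a) {s : ℝ} {V : H →L[ℂ] H}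
    (hV : StepPropagator A B w s V) (ψ : A.domain) :
    ∃ hm : V ψ ∈ A.domain, ∃ p ∈ Icc 0 s, h.energy (w p) ⟨V ψ, hm⟩ ≤
      Real.exp (a / δ * variationUpTo w p) * h.energy 0 ψ := by
  have ha := h.a_pos; have hδ0 := hδ.1
  have hca : ∀ t, |w t| * a ≤ 1 - δ := fun t => (abs_mul_lt_of_mem_controls ha hw t).le
  induction hV with
  | zero =>
    refine ⟨ψ.2, 0, left_mem_Icc.2 le_rfl, ?_⟩
    rw [hw.2.1 0 le_rfl]
    exact le_mul_of_one_le_left (h.energy_nonneg _ _)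
      (Real.one_le_exp (mul_nonneg (by positivity) ENNReal.toReal_nonneg))
  | @step s V hV τ c hτ hc U hU ih =>
    obtain ⟨hm, p, hp, hE⟩ := ih
    -- A step of length zero has no interior point, so its value `c` is unrelated to `w`; it is
    -- discarded because `U 0 = 1`.
    rcases hτ.eq_or_lt with rfl | hτ
    · have e : (U 0 ∘L V) ψ = V ψ := by rw [hU.map_zero]; rfl
      refine ⟨e ▸ hm, p, by rwa [add_zero], ?_⟩
      convert hE using 2
      exact Subtype.ext e
    · rw [add_smul_eq hAB] at hU
      obtain ⟨hm', he⟩ := hU.exists_apply ⟨V ψ, hm⟩ τ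
      have hpq : p ≤ s + τ / 2 := by linarith [hp.2]
      -- Only the interior of a step determines `c`; the value of `w` at its endpoints is arbitrary.
      -- Sampling at the midpoint therefore identifies `c`, and the jumps between successive sample
      -- points add up to at most the total variation.
      refine ⟨hm', s + τ / 2, ⟨hp.1.trans hpq, by linarith⟩, ?_⟩
      rw [← hc (s + τ / 2) ⟨by linarith, by linarith⟩] at he
      have e1 : h.energy (w (s + τ / 2)) ⟨(U τ ∘L V) ψ, hm'⟩ =
          h.energy (w (s + τ / 2)) ⟨V ψ, hm⟩ := by
        have e2 : ‖genOn hAB (w (s + τ / 2)) ⟨(U τ ∘L V) ψ, hm'⟩‖ =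
            ‖genOn hAB (w (s + τ / 2)) ⟨V ψ, hm⟩‖ :=
          (congrArg norm he).trans (hU.isometric τ _)
        unfold energy
        rw [e2]
        simp only [ContinuousLinearMap.comp_apply, hU.isometric]
      rw [e1]
      calc _ ≤ Real.exp (a / δ * |w (s + τ / 2) - w p|) * h.energy (w p) ⟨V ψ, hm⟩ :=
            h.energy_le_energy hδ (hca p) _ _
        _ ≤ Real.exp (a / δ * |w (s + τ / 2) - w p|) *
            (Real.exp (a / δ * variationUpTo w p) * h.energy 0 ψ) := by gcongr
        _ = Real.exp (a / δ * (|w (s + τ / 2) - w p| + variationUpTo w p)) * h.energy 0 ψ := by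
            rw [mul_add, Real.exp_add, mul_assoc]
        _ ≤ _ := by
            have := abs_sub_add_variationUpTo_le hw.1 hp.1 hpq
            have := h.energy_nonneg 0 ψ
            gcongr

/-- The bound for `‖A Υ_t ψ‖` under controls of total variation at most `K`. -/
noncomputable def growthBound (h : DiagonalPair A.domain A.toFun (restrictTo B hAB) φ lam a b)
    (δ K : ℝ) (ψ : A.domain) : ℝ :=
  Real.exp (a / δ * K) * h.energy 0 ψ / δ

theorem growthBound_nonneg (h : DiagonalPair A.domain A.toFun (restrictTo B hAB) φ lam a b)
    (hδ : δ ∈ Ioo (0 : ℝ) 1) (K : ℝ) (ψ : A.domain) : 0 ≤ h.growthBound δ K ψ := by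
  have := h.energy_nonneg 0 ψ; have := hδ.1
  unfold growthBound; positivity

/-- The control enters only through the variation bound `K`: neither the elapsed time nor the number
of steps appears. This makes the tail estimate uniform along all trajectories. -/
theorem norm_diag_stepPropagator_le
    (h : DiagonalPair A.domain A.toFun (restrictTo B hAB) φ lam a b)
    (hδ : δ ∈ Ioo (0 : ℝ) 1) {w : ℝ → ℝ} (hw : w ∈ controls δ a) {s : ℝ} {V : H →L[ℂ] H}
    (hV : StepPropagator A B w s V) {K : ℝ} (hK : variationUpTo w s ≤ K) (ψ : A.domain) :
    ∃ hm : V ψ ∈ A.domain, ‖A ⟨V ψ, hm⟩‖ ≤ h.growthBound δ K ψ := by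
  have ha := h.a_pos; have hb := h.b_nonneg; have hδ0 := hδ.1
  obtain ⟨hm, p, hp, hE⟩ := h.energy_stepPropagator hδ hw hV ψ
  refine ⟨hm, ?_⟩
  have h1 := h.norm_le_energy hδ (abs_mul_lt_of_mem_controls ha hw p).le ⟨V ψ, hm⟩
  have h2 : 0 ≤ b / a * ‖V ψ‖ := by positivity
  have h3 := abs_sub_add_variationUpTo_le hw.1 hp.1 hp.2
  have h4 : variationUpTo w p ≤ K := by linarith [abs_nonneg (w s - w p)]
  have h5 : Real.exp (a / δ * variationUpTo w p) * h.energy 0 ψ ≤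
      Real.exp (a / δ * K) * h.energy 0 ψ := by
    have := h.energy_nonneg 0 ψ
    gcongr
  rw [growthBound, le_div_iff₀' hδ0]
  linarith

end DiagonalPair

/-! ### Comparison of step propagators with the Galerkin propagator -/

theorem intervalIntegrable_of_abs_le {f : ℝ → ℝ} (hf : Measurable f) {M : ℝ}
    (hM : ∀ t, |f t| ≤ M) (p q : ℝ) : IntervalIntegrable f volume p q :=
  IntervalIntegrable.mono_fun (f := fun _ => M) (by simp) hf.aestronglyMeasurable
    (ae_of_all _ fun t => (hM t).trans (Real.le_norm_self _))

theorem intervalIntegrable_affine_apply (P Q : H →L[ℂ] H) {u : ℝ → ℝ} (hu : Measurable u) {M : ℝ}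
    (hM : ∀ t, |u t| ≤ M) {y : ℝ → H} (hy : Continuous y) (p q : ℝ) :
    IntervalIntegrable (fun r => (P + (u r : ℂ) • Q) (y r)) volume p q := by
  have h1 : Continuous fun r => P (y r) := P.continuous.comp hy
  have h2 : Continuous fun r => Q (y r) := Q.continuous.comp hy
  refine (h1.intervalIntegrable p q).add ?_
  refine IntervalIntegrable.mono_fun (f := fun r => M * ‖Q (y r)‖)
    (Continuous.intervalIntegrable (by fun_prop) _ _)
    ((Complex.measurable_ofReal.comp hu).aestronglyMeasurable.smul h2.aestronglyMeasurable)
    (ae_of_all _ fun r => ?_)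
  change ‖(u r : ℂ) • Q (y r)‖ ≤ ‖M * ‖Q (y r)‖‖
  rw [norm_smul, Complex.norm_real, Real.norm_eq_abs]
  exact (mul_le_mul_of_nonneg_right (hM r) (norm_nonneg _)).trans (Real.le_norm_self _)

theorem abs_le_of_mem_controls {u : ℝ → ℝ} {δ a : ℝ} (hu : u ∈ controls δ a) (t : ℝ) :
    |u t| ≤ (1 - δ) / a := (abs_lt.2 (hu.2.2 t)).le

namespace IsGalerkinPropagator

theorem continuous_apply {A B : H →ₗ.[ℂ] H} {φ : HilbertBasis ℕ ℂ H} {N : ℕ} {u : ℝ → ℝ}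
    {X : ℝ → ℝ → H →L[ℂ] H} (hX : IsGalerkinPropagator A B φ N u X) (s : ℝ) (x : H) :
    Continuous fun t => X t s x :=
  (ContinuousLinearMap.apply ℂ H x).continuous.comp (hX s).1

theorem apply_eq [CompleteSpace H] {A B : H →ₗ.[ℂ] H} {φ : HilbertBasis ℕ ℂ H} {N : ℕ} {u : ℝ → ℝ}
    {X : ℝ → ℝ → H →L[ℂ] H} (hX : IsGalerkinPropagator A B φ N u X) (hu : Measurable u) {M : ℝ}
    (hM : ∀ t, |u t| ≤ M) (x : H) {s t : ℝ} :
    X t 0 x = X s 0 x + ∫ r in s..t,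
      (compression A φ N + (u r : ℂ) • compression B φ N) (X r 0 x) := by
  have hF : ∀ p q, IntervalIntegrable (fun r =>
      (compression A φ N + (u r : ℂ) • compression B φ N) ∘L X r 0) volume p q := fun p q => by
    have hc := (hX 0).1
    refine IntervalIntegrable.mono_fun
      (f := fun r => (‖compression A φ N‖ + M * ‖compression B φ N‖) * ‖X r 0‖)
      (Continuous.intervalIntegrable (by fun_prop) _ _) ?_ (ae_of_all _ fun r => ?_)
    · exact (((stronglyMeasurable_const.add
        ((Complex.measurable_ofReal.comp hu).stronglyMeasurable.smul_const _)).mul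
        hc.stronglyMeasurable).aestronglyMeasurable : AEStronglyMeasurable (fun r =>
          (compression A φ N + (u r : ℂ) • compression B φ N) * X r 0) _)
    · refine (ContinuousLinearMap.opNorm_comp_le _ _).trans ?_
      refine le_trans ?_ (Real.le_norm_self _)
      gcongr
      refine (norm_add_le _ _).trans ?_
      rw [norm_smul, Complex.norm_real, Real.norm_eq_abs]
      gcongr
      exact hM r
  have h0 : ∀ t, X t 0 x = x + ∫ r in (0 : ℝ)..t,
      (compression A φ N + (u r : ℂ) • compression B φ N) (X r 0 x) := fun t => by
    rw [(hX 0).2 t, add_apply, ContinuousLinearMap.intervalIntegral_apply (hF 0 t)]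
    rfl
  have hI : ∀ p q, IntervalIntegrable (fun r =>
      (compression A φ N + (u r : ℂ) • compression B φ N) (X r 0 x)) volume p q :=
    intervalIntegrable_affine_apply _ _ hu hM (hX.continuous_apply 0 x)
  rw [h0 t, h0 s, add_assoc, intervalIntegral.integral_add_adjacent_intervals (hI _ _) (hI _ _)]

end IsGalerkinPropagator

namespace DiagonalPair

variable {A B : H →ₗ.[ℂ] H} {hAB : A.domain ≤ B.domain} {φ : HilbertBasis ℕ ℂ H} {lam : ℕ → ℝ}
  {a b δ : ℝ}

theorem compression_eq (h : DiagonalPair A.domain A.toFun (restrictTo B hAB) φ lam a b) (N : ℕ) :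
    compression A φ N = h.galerkinOp A.toFun N ∧
      compression B φ N = h.galerkinOp (restrictTo B hAB) N := by
  constructor
  · refine Finset.sum_congr rfl fun k _ => ?_
    rw [value, dif_pos (h.basis_mem k)]; rfl
  · refine Finset.sum_congr rfl fun k _ => ?_
    rw [value, dif_pos (hAB (h.basis_mem k))]; rfl

theorem compression_add_smul (h : DiagonalPair A.domain A.toFun (restrictTo B hAB) φ lam a b)
    (N : ℕ) (c : ℝ) : compression A φ N + (c : ℂ) • compression B φ N =
      h.galerkinOp (genOn hAB c) N := by
  rw [(h.compression_eq N).1, (h.compression_eq N).2, genOn, galerkinOp_add_smul]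

/-- The defect of `π_N` intertwining the full and the Galerkin vector field. -/
theorem norm_defect_le (h : DiagonalPair A.domain A.toFun (restrictTo B hAB) φ lam a b)
    {N : ℕ} {ε : ℝ} (hN : ∀ x y : A.domain, (y : H) = x - proj φ N x →
      ‖(y : H)‖ ≤ ε * ‖A x‖ ∧ ‖restrictTo B hAB y‖ ≤ ε * ‖A x‖) (c c' : ℝ) (y : A.domain) :
    ‖proj φ N (genOn hAB c y) - h.galerkinOp (genOn hAB c') N y‖ ≤
      ‖compression B φ N‖ * |c - c'| * ‖(y : H)‖ + |c| * (ε * ‖A y‖) := by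
  -- The `A` terms cancel since `π_N` commutes with `A`. The mismatch of the controls multiplies the
  -- bounded operator `π_N B π_N`, so the unbounded `B` meets only the tail of `y`.
  have e : proj φ N (genOn hAB c y) - h.galerkinOp (genOn hAB c') N y =
      ((c - c' : ℝ) : ℂ) • compression B φ N y +
        (c : ℂ) • proj φ N (restrictTo B hAB (y - h.projD N y)) := by
    have hA : proj φ N (A.toFun (h.projD N y)) = proj φ N (A.toFun y) := by
      rw [h.diag_projD, proj_proj_of_le φ le_rfl]
    rw [(h.compression_eq N).2, galerkinOp_apply, galerkinOp_apply]
    simp only [genOn, LinearMap.add_apply, LinearMap.smul_apply, map_add, map_sub, map_smul, hA,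
      Complex.ofReal_sub, sub_smul, smul_sub]
    abel
  rw [e]
  refine (norm_add_le _ _).trans (add_le_add ?_ ?_)
  · rw [norm_smul, Complex.norm_real, Real.norm_eq_abs, mul_comm ‖compression B φ N‖, mul_assoc]
    gcongr
    exact ContinuousLinearMap.le_opNorm _ _
  · rw [norm_smul, Complex.norm_real, Real.norm_eq_abs]
    gcongr
    exact (norm_proj_le φ N _).trans (hN y _ rfl).2

variable [CompleteSpace H]

/-- The projected trajectory of a step control `w` stays close to the Galerkin trajectory of `u`. -/
theorem norm_proj_stepPropagator_sub_le
    (h : DiagonalPair A.domain A.toFun (restrictTo B hAB) φ lam a b)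
    (hδ : δ ∈ Ioo (0 : ℝ) 1) {u w : ℝ → ℝ} (hu : u ∈ controls δ a) (hw : w ∈ controls δ a)
    {N : ℕ} {ε : ℝ} (hε : 0 ≤ ε) (hN : ∀ x y : A.domain, (y : H) = x - proj φ N x →
      ‖(y : H)‖ ≤ ε * ‖A x‖ ∧ ‖restrictTo B hAB y‖ ≤ ε * ‖A x‖)
    {X : ℝ → ℝ → H →L[ℂ] H} (hX : IsGalerkinPropagator A B φ N u X) (ψ : A.domain)
    {s : ℝ} {V : H →L[ℂ] H} (hV : StepPropagator A B w s V) {K : ℝ} (hK : variationUpTo w s ≤ K) :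
    ‖proj φ N (V ψ) - X s 0 (proj φ N ψ)‖ ≤ ∫ r in (0 : ℝ)..s,
      (‖compression B φ N‖ * |w r - u r| * ‖(ψ : H)‖ + |w r| * (ε * h.growthBound δ K ψ)) := by
  have hum := measurable_of_boundedVariationOn hu.1
  have hwm := measurable_of_boundedVariationOn hw.1
  have hub := abs_le_of_mem_controls hu
  have hwb := abs_le_of_mem_controls hw
  have hC0 := h.growthBound_nonneg hδ K ψ
  set C := h.growthBound δ K ψ with hC
  have hgi : ∀ v : ℝ → ℝ, Measurable v → (∀ t, |v t| ≤ (1 - δ) / a) → ∀ p q,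
      IntervalIntegrable (fun r => ‖compression B φ N‖ * |v r - u r| * ‖(ψ : H)‖ +
        |v r| * (ε * C)) volume p q := fun v hv hvb p q => by
    have i1 := intervalIntegrable_of_abs_le hv hvb p q
    have i2 := intervalIntegrable_of_abs_le hum hub p q
    exact (((i1.sub i2).abs.const_mul _).mul_const _).add (i1.abs.mul_const _)
  induction hV with
  | zero =>
    have : X 0 0 = 1 := by rw [(hX 0).2 0]; simp
    simp [this]
  | @step s V hV τ c hτ hc U hU ih =>
    have hs := hV.nonneg
    have hmono : ∀ r, s ≤ r → r ≤ s + τ → variationUpTo w r ≤ K := fun r h1 h2 => by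
      have := abs_sub_add_variationUpTo_le hw.1 (hs.trans h1) h2
      linarith [abs_nonneg (w (s + τ) - w r)]
    have ih := ih (hmono s le_rfl (by linarith))
    rcases hτ.eq_or_lt with rfl | hτ
    · simp only [add_zero, hU.map_zero]
      exact ih
    have hcb : |c| ≤ (1 - δ) / a := by
      rw [← hc (s + τ / 2) ⟨by linarith, by linarith⟩]; exact hwb _
    have hU' := hU
    rw [add_smul_eq hAB] at hU'
    obtain ⟨hVm, -⟩ := h.norm_diag_stepPropagator_le hδ hw hV (hmono s le_rfl (by linarith)) ψ
    set x : A.domain := ⟨V ψ, hVm⟩ with hx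
    set y : ℝ → H := fun r => U (r - s) x with hy
    have hyc : Continuous y := (hU.continuous x).comp (continuous_id.sub continuous_const)
    set y' : ℝ → H := fun r => U (r - s) (genOn hAB c x) with hy'
    have hy'c : Continuous y' := (hU.continuous _).comp (continuous_id.sub continuous_const)
    have hyd : ∀ r, HasDerivAt y (y' r) r := fun r =>
      (hU'.hasDerivAt x (r - s)).comp_sub_const r s
    set G : ℝ → H →L[ℂ] H := fun r => compression A φ N + (u r : ℂ) • compression B φ N with hG
    have hGe : ∀ r, G r = h.galerkinOp (genOn hAB (u r)) N := fun r => h.compression_add_smul N (u r)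
    have hGp : ∀ r x, G r (proj φ N x) = G r x := fun r x => by
      rw [hGe, galerkinOp_apply, galerkinOp_apply, projD_proj]
    set ξ : ℝ → H := fun r => X r 0 (proj φ N ψ) with hξ
    have hξc : Continuous ξ := hX.continuous_apply 0 _
    have hzc : Continuous fun r => proj φ N (y r) - ξ r :=
      ((proj φ N).continuous.comp hyc).sub hξc
    have hGi : ∀ (z : ℝ → H), Continuous z → ∀ p q,
        IntervalIntegrable (fun r => G r (z r)) volume p q := fun z hz p q =>
      intervalIntegrable_affine_apply _ _ hum hub hz p q
    have hpy' : Continuous fun r => proj φ N (y' r) := (proj φ N).continuous.comp hy'c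
    have hys : y s = V ψ := by
      simp only [hy, sub_self, hU.map_zero]; rfl
    have hLb : ∀ r, ‖G r‖ ≤ ‖compression A φ N‖ + (1 - δ) / a * ‖compression B φ N‖ := fun r => by
      refine (norm_add_le _ _).trans ?_
      rw [norm_smul, Complex.norm_real, Real.norm_eq_abs]
      gcongr
      exact hub r
    have hre : ∀ r x, (⟪x, G r x⟫_ℂ).re = 0 := fun r x => by
      rw [hGe]
      have h1 := congrArg Complex.re (h.inner_galerkinOp (h.skew_add (u r)) N x x)
      rw [← inner_conj_symm, Complex.conj_re, Complex.neg_re] at h1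
      change _ = -(⟪x, h.galerkinOp (genOn hAB (u r)) N x⟫_ℂ).re at h1
      change (⟪x, h.galerkinOp (genOn hAB (u r)) N x⟫_ℂ).re = _ at h1
      linarith
    -- On one step, the difference `z` of the projected trajectory and the Galerkin trajectory
    -- solves `z' = G z + f` in integral form, with `G` the skew Galerkin generator of `u` and `f`
    -- the defect.
    have key := norm_le_of_skew_integral_eq (C := G) hLb hre (le_add_of_nonneg_right hτ.le : s ≤ s + τ)
      (z := fun r => proj φ N (y r) - ξ r) (f := fun r => proj φ N (y' r) - G r (y r))
      (g := fun r => ‖compression B φ N‖ * |c - u r| * ‖(ψ : H)‖ + |c| * (ε * C))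
      hzc.continuousOn (fun z => hGi _ continuous_const _ _) (hGi _ hzc _ _)
      ((hpy'.intervalIntegrable _ _).sub (hGi _ hyc _ _))
      (hgi (fun _ => c) measurable_const (fun _ => hcb) _ _) (fun r hr => ?_) (fun r hr => ?_)
    · simp only [hys] at key
      have e1 : y (s + τ) = (U τ ∘L V) ψ := by simp [hy, hx]
      rw [e1] at key
      refine key.trans ?_
      rw [← intervalIntegral.integral_add_adjacent_intervals (hgi w hwm hwb 0 s)
        (hgi w hwm hwb s (s + τ))]
      refine add_le_add ih (le_of_eq ?_)
      -- `w` equals `c` only on the open step; the endpoints are negligible for the integral.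
      refine intervalIntegral.integral_congr_Ioo_of_le (by linarith) fun r hr => ?_
      simp only [hc r hr]
    · obtain ⟨hm, he⟩ := hU'.exists_apply x (r - s)
      have hstep : StepPropagator A B w (s + (r - s)) (U (r - s) ∘L V) :=
        StepPropagator.step hV (r - s) c (by linarith [hr.1])
          (fun q hq => hc q ⟨hq.1, by linarith [hq.2, hr.2]⟩) U hU
      obtain ⟨hm2, hA2⟩ := h.norm_diag_stepPropagator_le hδ hw hstep
        (hmono _ (by linarith [hr.1]) (by linarith [hr.2])) ψ
      have h1 := h.norm_defect_le hN c (u r) ⟨U (r - s) x, hm⟩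
      have e2 : y' r = genOn hAB c ⟨U (r - s) x, hm⟩ := he.symm
      rw [e2, hGe]
      refine h1.trans (add_le_add (le_of_eq ?_) ?_)
      · simp only [hU.isometric, hx, hV.norm_apply]
      · gcongr
        exact hA2
    · have e3 : proj φ N (y r) = proj φ N (y s) + ∫ q in s..r, proj φ N (y' q) := by
        have hpd : ∀ q, HasDerivAt (fun r => proj φ N (y r)) (proj φ N (y' q)) q := fun q =>
          ((proj φ N).restrictScalars ℝ).hasFDerivAt.comp_hasDerivAt q (hyd q)
        rw [intervalIntegral.integral_eq_sub_of_hasDerivAt (fun q _ => hpd q)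
          (hpy'.intervalIntegrable _ _)]
        abel
      have e4 : ξ r = ξ s + ∫ q in s..r, G q (ξ q) := hX.apply_eq hum hub _
      rw [e3, e4, add_sub_add_comm, ← intervalIntegral.integral_sub (hpy'.intervalIntegrable _ _)
        (hGi _ hξc _ _)]
      congr 1
      refine intervalIntegral.integral_congr fun q _ => ?_
      simp only [map_sub, hGp]
      abel

end DiagonalPair

/-! ### Passage to general controls -/

theorem variationUpTo_le {u w : ℝ → ℝ} (hu : BoundedVariationOn u univ) {t T : ℝ} (htT : t ≤ T)
    (h : eVariationOn w (Icc 0 T) ≤ eVariationOn u (Icc 0 T)) :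
    variationUpTo w t ≤ variationUpTo u T :=
  ENNReal.toReal_mono (ne_top_of_le_ne_top hu (eVariationOn.mono u (subset_univ _)))
    ((eVariationOn.mono w (Icc_subset_Icc_right htT)).trans h)

namespace DiagonalPair

variable [CompleteSpace H] {A B : H →ₗ.[ℂ] H} {hAB : A.domain ≤ B.domain}
  {φ : HilbertBasis ℕ ℂ H} {lam : ℕ → ℝ} {a b δ : ℝ}

theorem exists_isUnitaryGroup_add_smul
    (h : DiagonalPair A.domain A.toFun (restrictTo B hAB) φ lam a b) {c : ℝ} (hc : |c| * a < 1) :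
    ∃ U, IsUnitaryGroup (A + (c : ℂ) • B) U := by
  rw [add_smul_eq hAB]
  exact h.exists_isUnitaryGroup hc

/-- Approximating step propagators are eventually close to the Galerkin propagator. -/
theorem eventually_norm_sub_galerkin_le
    (h : DiagonalPair A.domain A.toFun (restrictTo B hAB) φ lam a b)
    (hδ : δ ∈ Ioo (0 : ℝ) 1) {u : ℝ → ℝ} (hu : u ∈ controls δ a)
    {N : ℕ} {ε : ℝ} (hε : 0 ≤ ε) (hN : ∀ x y : A.domain, (y : H) = x - proj φ N x →
      ‖(y : H)‖ ≤ ε * ‖A x‖ ∧ ‖restrictTo B hAB y‖ ≤ ε * ‖A x‖)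
    {X : ℝ → ℝ → H →L[ℂ] H} (hX : IsGalerkinPropagator A B φ N u X) (ψ : A.domain)
    {T K : ℝ} (hK : variationUpTo u T ≤ K) {un : ℕ → ℝ → ℝ} {Υn : ℕ → ℝ → H →L[ℂ] H}
    (hn : IsStepApproximation A B δ a u T un Υn) {t : ℝ} (ht : t ∈ Icc 0 T) {η : ℝ} (hη : 0 < η) :
    ∀ᶠ n in atTop, ‖Υn n t ψ - X t 0 (proj φ N ψ)‖ ≤
      ε * h.growthBound δ K ψ * (1 + ∫ r in (0 : ℝ)..t, |u r|) + η := by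
  set C := h.growthBound δ K ψ with hC
  have hum := measurable_of_boundedVariationOn hu.1
  have hub := abs_le_of_mem_controls hu
  set β := ‖compression B φ N‖ with hβ
  -- With `N` fixed, `β` is a constant and the mismatch term disappears by dominated convergence,
  -- however large `β` may be. Only the tail term, proportional to `ε`, remains.
  have hlim : Tendsto (fun n => ∫ r in (0 : ℝ)..t,
      (β * |un n r - u r| * ‖(ψ : H)‖ + |un n r| * (ε * C))) atTop
      (𝓝 (∫ r in (0 : ℝ)..t, (β * |u r - u r| * ‖(ψ : H)‖ + |u r| * (ε * C)))) := by
    have hC0 : 0 ≤ C := h.growthBound_nonneg hδ K ψ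
    set M := (1 - δ) / a
    refine intervalIntegral.tendsto_integral_filter_of_dominated_convergence
      (fun _ => β * (M + M) * ‖(ψ : H)‖ + M * (ε * C)) (Eventually.of_forall fun n => ?_)
      (Eventually.of_forall fun n => ae_of_all _ fun r _ => ?_) (by simp)
      (ae_of_all _ fun r hr => ?_)
    · have hm := measurable_of_boundedVariationOn (hn.mem_controls n).1
      have h1 : Measurable fun r => |un n r - u r| := continuous_abs.measurable.comp (hm.sub hum)
      have h2 : Measurable fun r => |un n r| := continuous_abs.measurable.comp hm
      exact (((h1.const_mul β).mul_const _).add (h2.mul_const _)).aestronglyMeasurable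
    · have h1 := abs_le_of_mem_controls (hn.mem_controls n) r
      have h2 : |un n r - u r| ≤ M + M := (abs_sub _ _).trans (add_le_add h1 (hub r))
      rw [Real.norm_of_nonneg (by positivity)]
      gcongr
    · rw [uIoc_of_le ht.1] at hr
      have h1 := hn.pointwise r ⟨hr.1.le, hr.2.trans ht.2⟩
      exact ((((h1.sub_const (u r)).abs).const_mul β).mul_const _).add (h1.abs.mul_const _)
  have hval : (∫ r in (0 : ℝ)..t, (β * |u r - u r| * ‖(ψ : H)‖ + |u r| * (ε * C))) =
      (∫ r in (0 : ℝ)..t, |u r|) * (ε * C) := by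
    rw [← intervalIntegral.integral_mul_const]
    simp
  rw [hval] at hlim
  filter_upwards [hlim.eventually (gt_mem_nhds (lt_add_of_pos_right _ hη))] with n hnlt
  have hV := hn.step n t ht
  have hKn := (variationUpTo_le hu.1 ht.2 (hn.variation_le n)).trans hK
  have h1 := h.norm_proj_stepPropagator_sub_le hδ hu (hn.mem_controls n) hε hN hX ψ hV hKn
  obtain ⟨hm, hA⟩ := h.norm_diag_stepPropagator_le hδ (hn.mem_controls n) hV hKn ψ
  have h2 := (hN ⟨Υn n t ψ, hm⟩ (⟨Υn n t ψ, hm⟩ - h.projD N (Υn n t ψ)) rfl).1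
  have h3 : ‖Υn n t ψ - proj φ N (Υn n t ψ)‖ ≤ ε * C := h2.trans (by gcongr)
  calc _ ≤ ‖Υn n t ψ - proj φ N (Υn n t ψ)‖ + ‖proj φ N (Υn n t ψ) - X t 0 (proj φ N ψ)‖ :=
        norm_sub_le_norm_sub_add_norm_sub _ _ _
    _ ≤ ε * C + ((∫ r in (0 : ℝ)..t, |u r|) * (ε * C) + η) :=
        add_le_add h3 (h1.trans hnlt.le)
    _ = _ := by ring

/-- Any two step approximations have asymptotically equal propagators. -/
theorem exists_forall_eventually_norm_sub_le
    (h : DiagonalPair A.domain A.toFun (restrictTo B hAB) φ lam a b)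
    (hδ : δ ∈ Ioo (0 : ℝ) 1) {u : ℝ → ℝ} (hu : u ∈ controls δ a) (ψ : A.domain) {t T : ℝ}
    (ht : t ∈ Icc 0 T) {η : ℝ} (hη : 0 < η) :
    ∃ x : H, ∀ T' ∈ Icc t T, ∀ un Υn, IsStepApproximation A B δ a u T' un Υn →
      ∀ᶠ n in atTop, ‖Υn n t ψ - x‖ ≤ η := by
  set K := variationUpTo u T
  have hC := h.growthBound_nonneg hδ K ψ
  have hI : 0 ≤ ∫ r in (0 : ℝ)..t, |u r| :=
    intervalIntegral.integral_nonneg ht.1 fun _ _ => abs_nonneg _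
  set Q := h.growthBound δ K ψ * (1 + ∫ r in (0 : ℝ)..t, |u r|) with hQ
  have hQ0 : 0 ≤ Q := by positivity
  set ε := η / 2 / (Q + 1)
  have hε : 0 < ε := by positivity
  obtain ⟨N, hN⟩ := h.tail ε hε
  obtain ⟨X, hX⟩ := exists_isGalerkinPropagator A B φ N
    (measurable_of_boundedVariationOn hu.1) (abs_le_of_mem_controls hu)
  -- The Galerkin value of `u` is a reference point shared by all approximations. The constant `K`
  -- is taken for the largest horizon `T`, so the point does not depend on `T'`.
  refine ⟨X t 0 (proj φ N ψ), fun T' hT' un Υn hn => ?_⟩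
  filter_upwards [h.eventually_norm_sub_galerkin_le hδ hu hε.le (hN N le_rfl) hX ψ
    (variationUpTo_le hu.1 hT'.2 le_rfl : variationUpTo u T' ≤ K) hn ⟨ht.1, hT'.1⟩ (half_pos hη)]
    with n hn
  refine hn.trans ?_
  rw [mul_assoc, ← hQ]
  have : ε * Q ≤ η / 2 := by
    calc ε * Q ≤ ε * (Q + 1) := by gcongr; linarith
      _ = η / 2 := div_mul_cancel₀ _ (by positivity)
  linarith

/-- One approximation on `[0, t]` converges because its terms are eventually close to a common
point, at every precision. Any approximation on a longer interval is eventually close to the same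
points, so its limit at time `t` is the same. -/
theorem exists_limit_propagator
    (h : DiagonalPair A.domain A.toFun (restrictTo B hAB) φ lam a b)
    (hδ : δ ∈ Ioo (0 : ℝ) 1) {u : ℝ → ℝ} (hu : u ∈ controls δ a) {t : ℝ} (ht : 0 ≤ t) :
    ∃ L : H →L[ℂ] H, ∀ T, t ≤ T → ∀ un Υn, IsStepApproximation A B δ a u T un Υn →
      ∀ ψ ∈ A.domain, Tendsto (fun n => Υn n t ψ) atTop (𝓝 (L ψ)) := by
  have ha := h.a_pos
  have hU : ∀ r, ∃ U, IsUnitaryGroup (A + (u r : ℂ) • B) U := fun r =>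
    h.exists_isUnitaryGroup_add_smul
      ((abs_mul_lt_of_mem_controls ha hu r).trans (by linarith [hδ.1]))
  obtain ⟨un, Υn, hn⟩ := exists_isStepApproximation hu hU ht
  have htt : t ∈ Icc 0 t := ⟨ht, le_rfl⟩
  obtain ⟨L, hL⟩ := exists_strong_limit (V := fun n => Υn n t)
    (fun n x => ((hn.step n t htt).norm_apply x).le) h.dense (fun x hx => by
      rw [Metric.cauchySeq_iff]
      intro η hη
      obtain ⟨y, hy⟩ := h.exists_forall_eventually_norm_sub_le hδ hu ⟨x, hx⟩ htt
        (by positivity : 0 < η / 3)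
      obtain ⟨n₀, hn₀⟩ := eventually_atTop.1 (hy t ⟨le_rfl, le_rfl⟩ un Υn hn)
      refine ⟨n₀, fun m hm n hn => ?_⟩
      have h1 := hn₀ m hm
      have h2 := hn₀ n hn
      rw [← dist_eq_norm] at h1 h2
      have := dist_triangle_right (Υn m t x) (Υn n t x) y
      linarith)
  refine ⟨L, fun T hT un' Υn' hn' ψ hψ => ?_⟩
  rw [Metric.tendsto_atTop']
  intro η hη
  obtain ⟨y, hy⟩ := h.exists_forall_eventually_norm_sub_le hδ hu ⟨ψ, hψ⟩ ⟨ht, hT⟩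
    (by positivity : 0 < η / 3)
  have h1 := hy T ⟨hT, le_rfl⟩ un' Υn' hn'
  have h2 : ‖L ψ - y‖ ≤ η / 3 :=
    le_of_tendsto ((hL ψ).sub_const y).norm (hy t ⟨le_rfl, hT⟩ un Υn hn)
  obtain ⟨n₀, hn₀⟩ := eventually_atTop.1 h1
  refine ⟨n₀, fun n hn => ?_⟩
  have h3 := hn₀ n hn.le
  rw [← dist_eq_norm] at h2 h3
  have := dist_triangle_right (Υn' n t ψ) (L ψ) y
  dsimp only at h3
  linarith

theorem isPropagator_propagator
    (h : DiagonalPair A.domain A.toFun (restrictTo B hAB) φ lam a b)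
    (hδ : δ ∈ Ioo (0 : ℝ) 1) {u : ℝ → ℝ} (hu : u ∈ controls δ a) :
    IsPropagator A B δ a u (propagator A B δ a u) := by
  have hex : ∃ Υ, IsPropagator A B δ a u Υ := by
    choose! Υ hΥ using fun t ht => h.exists_limit_propagator hδ hu (t := t) ht
    refine ⟨Υ, fun T hT => ⟨exists_isStepApproximation hu (fun r =>
      h.exists_isUnitaryGroup_add_smul ((abs_mul_lt_of_mem_controls h.a_pos hu r).trans
        (by linarith [hδ.1]))) hT, fun un Υn hn t ht ψ hψ => hΥ t ht.1 T ht.2 un Υn hn ψ hψ⟩⟩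
  rw [propagator, dif_pos hex]
  exact hex.choose_spec

theorem norm_propagator_sub_galerkin_le
    (h : DiagonalPair A.domain A.toFun (restrictTo B hAB) φ lam a b)
    (hδ : δ ∈ Ioo (0 : ℝ) 1) {u : ℝ → ℝ} (hu : u ∈ controls δ a)
    {N : ℕ} {ε : ℝ} (hε : 0 ≤ ε) (hN : ∀ x y : A.domain, (y : H) = x - proj φ N x →
      ‖(y : H)‖ ≤ ε * ‖A x‖ ∧ ‖restrictTo B hAB y‖ ≤ ε * ‖A x‖)
    {X : ℝ → ℝ → H →L[ℂ] H} (hX : IsGalerkinPropagator A B φ N u X) {Υ : ℝ → H →L[ℂ] H}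
    (hΥ : IsPropagator A B δ a u Υ) (ψ : A.domain) {t K : ℝ} (ht : 0 ≤ t)
    (hK : variationUpTo u t ≤ K) :
    ‖Υ t ψ - X t 0 (proj φ N ψ)‖ ≤
      ε * h.growthBound δ K ψ * (1 + ∫ r in (0 : ℝ)..t, |u r|) := by
  obtain ⟨⟨un, Υn, hn⟩, hlim⟩ := hΥ t ht
  have htt : t ∈ Icc 0 t := ⟨ht, le_rfl⟩
  refine le_of_forall_pos_le_add fun η hη => ?_
  exact le_of_tendsto ((hlim un Υn hn t htt ψ ψ.2).sub_const _).norm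
    (h.eventually_norm_sub_galerkin_le hδ hu hε hN hX ψ hK hn htt hη)

end DiagonalPair

theorem isGalerkinPropagator_galerkinPropagator [CompleteSpace H] (A B : H →ₗ.[ℂ] H)
    (φ : HilbertBasis ℕ ℂ H) (N : ℕ) {u : ℝ → ℝ} {δ a : ℝ} (hu : u ∈ controls δ a) :
    IsGalerkinPropagator A B φ N u (galerkinPropagator A B φ N u) := by
  have hex := exists_isGalerkinPropagator A B φ N (measurable_of_boundedVariationOn hu.1)
    (abs_le_of_mem_controls hu)
  rw [galerkinPropagator, dif_pos hex]
  exact hex.choose_spec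

end BilinearControl

/-! ### Choice of the Galerkin order -/

open BilinearControl
theorem mainTheorem3 {H : Type*} [NormedAddCommGroup H] [InnerProductSpace ℂ H] [CompleteSpace H]
    (A B : H →ₗ.[ℂ] H) (φ : HilbertBasis ℕ ℂ H) (lam : ℕ → ℝ) (α a b δ : ℝ)
    (hδ : δ ∈ Set.Ioo (0 : ℝ) 1) (hα : α < 1) (ha : 0 < a)
    (hyp : Hypothesis2 A B φ lam α a b)
    (ε : ℝ) (hε : 0 < ε) (K : ℝ) (hK : 0 ≤ K)
    (n : ℕ) (ψ : Fin n → H) (hψ : ∀ j, ψ j ∈ (absPow φ lam 1).domain) :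
    ∃ N : ℕ, 1 ≤ N ∧ ∀ u ∈ controls δ a, MeasureTheory.Integrable u →
      (∫ t, |u t|) + (eVariationOn u Set.univ).toReal < K →
        IsPropagator A B δ a u (propagator A B δ a u) ∧
        IsGalerkinPropagator A B φ N u (galerkinPropagator A B φ N u) ∧
        ∀ t : ℝ, 0 ≤ t → ∀ j,
          ‖propagator A B δ a u t (ψ j)
            - galerkinPropagator A B φ N u t 0 (proj φ N (ψ j))‖ < ε := by
  have h := hyp.diagonalPair hα ha
  have hψA : ∀ j, ψ j ∈ A.domain := fun j => hyp.mem_domain_of_absPow_one (hψ j)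
  set C : Fin n → ℝ := fun j => h.growthBound δ K ⟨ψ j, hψA j⟩ with hC
  have hC0 : ∀ j, 0 ≤ C j := fun j => h.growthBound_nonneg hδ K _
  have hS0 : 0 ≤ ∑ j, C j := Finset.sum_nonneg fun j _ => hC0 j
  -- The error for `ψ j` is at most `η * C j * (1 + ‖u‖_{L¹})`. The sum bounds all `C j` at once,
  -- `K` bounds both the `L¹` norm and the variation, and the added `1` makes the final inequality
  -- strict.
  set η := ε / ((∑ j, C j + 1) * (1 + K)) with hη
  have hη0 : 0 < η := by positivity
  obtain ⟨N₀, hN₀⟩ := h.tail η hη0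
  refine ⟨max N₀ 1, le_max_right _ _, fun u hu hui huK => ?_⟩
  have hP := h.isPropagator_propagator hδ hu
  have hG := isGalerkinPropagator_galerkinPropagator A B φ (max N₀ 1) hu
  refine ⟨hP, hG, fun t ht j => ?_⟩
  have hI : ∫ r in (0 : ℝ)..t, |u r| ≤ ∫ r, |u r| := by
    rw [intervalIntegral.integral_of_le ht]
    exact setIntegral_le_integral hui.abs (ae_of_all _ fun _ => abs_nonneg _)
  have hI0 : 0 ≤ ∫ r, |u r| := integral_nonneg fun _ => abs_nonneg _
  have hV : variationUpTo u t ≤ (eVariationOn u univ).toReal :=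
    ENNReal.toReal_mono hu.1 (eVariationOn.mono u (subset_univ _))
  have hV0 : 0 ≤ (eVariationOn u univ).toReal := ENNReal.toReal_nonneg
  have key := h.norm_propagator_sub_galerkin_le hδ hu hη0.le (hN₀ _ (le_max_left _ _)) hG hP
    ⟨ψ j, hψA j⟩ ht (by linarith : variationUpTo u t ≤ K)
  have hCj : C j ≤ ∑ j, C j := Finset.single_le_sum (fun j _ => hC0 j) (Finset.mem_univ j)
  calc _ ≤ η * C j * (1 + ∫ r in (0 : ℝ)..t, |u r|) := key
    _ ≤ η * (∑ j, C j) * (1 + K) := by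
      have hI1 : 0 ≤ ∫ r in (0 : ℝ)..t, |u r| :=
        intervalIntegral.integral_nonneg ht fun _ _ => abs_nonneg _
      gcongr
      linarith
    _ < η * (∑ j, C j + 1) * (1 + K) := by gcongr; linarith
    _ = ε := by rw [hη]; field_simp
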